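/- Let $\mathbb T=\mathbb R/2\pi\mathbb Z$, with Fourier coefficients $\widehat f(n)=\frac1{2\pi}\int_{\mathbb T}f(x)e^{-inx}\,dx$, and let $\|f\|_{H^s}=\big(\sum_{n\in\mathbb Z}(1+n^2)^{s}|\widehat f(n)|^2\big)^{1/2}$. Let $(g_n)_{n\ge1}$ be independent standard complex-valued Gaussian random variables (real and imaginary parts independent, centred, of variance $\frac12$), put $g_{-n}=\overline{g_n}$, and let $\rho$ be the mean-zero periodic Wiener measure, i.e. the law on $L^2(\mathbb T)$ of the random Fourier series $$u(x)=\sum_{n\in\mathbb Z\setminus\{0\}}\frac{g_n}{|n|}e^{inx}.$$ Let $\mathbf P_N$ be the Dirichlet projection onto the frequencies $\{|n|\le N\}$ and $\mathbf P_\infty=\mathrm{Id}$. For an integer $k\ge2$ put $F_N(u)=\mathbf P_N[(\mathbf P_Nu)^k]$ and $F(u)=F_\infty(u)=u^k$. **Proposition 3.1.** Let $k\ge2$ be an integer and let $s<\frac12$. For all finite $p\ge1$ and all $N\in\mathbb N\cup\{\infty\}$, $F_N(u)$ is $\rho$-almost surely an integrable function belonging to $H^s(\mathbb T)$, and $F_N$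 belongs to $L^p(\rho;H^s(\mathbb T))$. Moreover: 1. There is $C_{k,s}>0$ such that, for every finite $p\ge1$ and every $N\in\mathbb N$, $$\|F_N(u)\|_{L^p(\rho;H^s)},\ \|F(u)\|_{L^p(\rho;H^s)}\le C_{k,s}\,(\max(p,2)-1)^{k/2}.$$ 2. For every $0<\varepsilon\le1$ with $s+\varepsilon<\frac12$ there is $C_{k,s,\varepsilon}>0$ such that, for every finite $p\ge1$, every integer $N\ge1$ and every $M$ with $N\le M\le\infty$, $$\|F_M(u)-F_N(u)\|_{L^p(\rho;H^s)}\le C_{k,s,\varepsilon}\,(\max(p,2)-1)^{k/2}\,\frac1{N^{\varepsilon}}.$$ 3. In particular, for every finite $p\ge1$, $F_N(u)\to F(u)=u^k$ in $L^p(\rho;H^s(\mathbb T))$ as $N\to\infty$. For $p\ge2$ the factor $(\max(p,2)-1)^{k/2}$ equals $(p-1)^{k/2}$; for $1\le p\le2$ it equals $1$. -/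

import Mathlib

open MeasureTheory ProbabilityTheory Filter Topology
open scoped ENNReal NNReal

noncomputable section

namespace BrownianLoop

/-- The circle `ℝ / 2πℤ`. -/
abbrev Torus : Type := AddCircle (2 * Real.pi)

instance factTwoPiPos : Fact (0 < 2 * Real.pi) := ⟨Real.two_pi_pos⟩

/-- Lebesgue measure on the circle, normalized to have mass one. -/
abbrev torusMeasure : Measure Torus := AddCircle.haarAddCircle

/-- `L²` of the circle, equipped with its Borel `σ`-algebra. -/
abbrev L2Torus : Type := Lp ℂ 2 torusMeasure

instance measurableSpaceL2Torus : MeasurableSpace L2Torus := borel L2Torus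

instance borelSpaceL2Torus : BorelSpace L2Torus := ⟨rfl⟩

/-! ### The mean-zero Brownian loop -/

/-- The standard complex Gaussian law on `ℂ`: real and imaginary parts are independent centred
real Gaussians of variance `1/2`, so that `E |g|² = 1`. -/
def stdComplexGaussian : Measure ℂ :=
  ((gaussianReal 0 (1 / 2)).prod (gaussianReal 0 (1 / 2))).map
    (fun q : ℝ × ℝ => (q.1 : ℂ) + (q.2 : ℂ) * Complex.I)

/-- The law of a sequence of independent standard complex Gaussians. -/
def gaussianNoise : Measure (ℕ → ℂ) :=
  Measure.infinitePi (fun _ : ℕ => stdComplexGaussian)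

/-- The family `(g_n)`, `n ∈ ℤ \ {0}`: `g_n = ω n` for `n > 0` and `g_{-n} = conj g_n`.
There is no zero mode: `g_0` is set to `0` and the coordinate `ω 0` is not used. -/
def gaussianCoeff (ω : ℕ → ℂ) (n : ℤ) : ℂ :=
  if 0 < n then ω n.natAbs
  else if n < 0 then starRingEnd ℂ (ω n.natAbs)
  else 0

/-- The Fourier-Wiener series `u(x) = ∑_{n ≠ 0} g_n / |n| e^{inx}`, which converges
unconditionally in `L²` for almost every `ω`. -/
def loop (ω : ℕ → ℂ) : L2Torus :=
  ∑' n : ℤ, (gaussianCoeff ω n / ((|n| : ℤ) : ℂ)) • (fourierLp 2 n : L2Torus)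

/-- The mean-zero periodic Wiener measure: the law of the Fourier-Wiener series on `L²`. -/
def wienerMeasure : Measure L2Torus := gaussianNoise.map loop

/-! ### The truncated nonlinearities -/

/-- The Dirichlet projection `P_N` onto the frequencies `|n| ≤ N`, with `P_∞ = Id`. -/
def dirichletProj (N : ℕ∞) (f : Torus → ℂ) : Torus → ℂ :=
  match N with
  | ⊤ => f
  | (n : ℕ) => fun x => ∑ j ∈ Finset.Icc (-(n : ℤ)) (n : ℤ), fourierCoeff f j * fourier j x

/-- `F_N(u) = P_N [(P_N u)^k]`, and `F_∞(u) = u^k`. -/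
def truncPow (k : ℕ) (N : ℕ∞) (u : L2Torus) : Torus → ℂ :=
  dirichletProj N (fun x => (dirichletProj N (u : Torus → ℂ) x) ^ k)

/-! ### The Sobolev spaces `H^s` -/

/-- The Fourier coefficients of `f`, multiplied by the Sobolev weight `(1 + n²)^{s/2}`. -/
def weightedCoeff (s : ℝ) (f : Torus → ℂ) (n : ℤ) : ℂ :=
  (((1 + (n : ℝ) ^ 2) ^ (s / 2) : ℝ) : ℂ) * fourierCoeff f n

/-- The Hilbert space `H^s` of the circle in Fourier coordinates: a distribution `f` with
`∑ (1 + n²)^s |f̂(n)|² < ∞` is represented by the square-summable family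
`((1 + n²)^{s/2} f̂(n))_n`, whose `ℓ²` norm is `‖f‖_{H^s}`. -/
abbrev Hs (_s : ℝ) : Type := lp (fun _ : ℤ => ℂ) 2

/-- `f` is an integrable function that belongs to `H^s`. -/
def MemHs (s : ℝ) (f : Torus → ℂ) : Prop :=
  Integrable f torusMeasure ∧ Memℓp (weightedCoeff s f) 2

open Classical in
/-- A function of `H^s` as an element of the space `H^s`
(with the value `0` for functions outside `H^s`). -/
def toHs (s : ℝ) (f : Torus → ℂ) : Hs s :=
  if h : MemHs s f then ⟨weightedCoeff s f, h.2⟩ else 0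

/-! ### The Wiener measure is a probability measure -/

instance isProbabilityMeasure_stdComplexGaussian : IsProbabilityMeasure stdComplexGaussian :=
  Measure.isProbabilityMeasure_map (by fun_prop)

instance isProbabilityMeasure_gaussianNoise : IsProbabilityMeasure gaussianNoise := by
  unfold gaussianNoise; infer_instance

lemma lintegral_sq_stdComplexGaussian_lt_top :
    ∫⁻ z, ‖z‖ₑ ^ 2 ∂stdComplexGaussian < ∞ := by
  have h1 : MemLp (fun q : ℝ × ℝ => (q.1 : ℂ)) 2
      ((gaussianReal 0 (1 / 2)).prod (gaussianReal 0 (1 / 2))) :=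
    ((memLp_id_gaussianReal 2).comp_fst _).ofReal
  have h2 : MemLp (fun q : ℝ × ℝ => (q.2 : ℂ) * Complex.I) 2
      ((gaussianReal 0 (1 / 2)).prod (gaussianReal 0 (1 / 2))) :=
    ((memLp_id_gaussianReal 2).comp_snd _).ofReal.mul_const _
  have h := (h1.add h2).eLpNorm_lt_top
  rw [eLpNorm_lt_top_iff_lintegral_rpow_enorm_lt_top (by norm_num) (by norm_num)] at h
  rw [stdComplexGaussian, lintegral_map (by fun_prop) (by fun_prop)]
  simpa using h

lemma lintegral_sq_gaussianCoeff_le (n : ℤ) :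
    ∫⁻ ω, ‖gaussianCoeff ω n‖ₑ ^ 2 ∂gaussianNoise ≤ ∫⁻ z, ‖z‖ₑ ^ 2 ∂stdComplexGaussian := by
  have key : ∫⁻ ω, ‖ω n.natAbs‖ₑ ^ 2 ∂gaussianNoise = ∫⁻ z, ‖z‖ₑ ^ 2 ∂stdComplexGaussian :=
    (measurePreserving_eval_infinitePi (fun _ : ℕ => stdComplexGaussian) n.natAbs).lintegral_comp
      (f := fun z : ℂ => ‖z‖ₑ ^ 2) (by fun_prop)
  rw [← key]
  refine lintegral_mono fun ω => ?_
  unfold gaussianCoeff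
  split_ifs <;> simp

lemma continuous_gaussianCoeff (n : ℤ) : Continuous fun ω => gaussianCoeff ω n := by
  unfold gaussianCoeff
  split_ifs
  · fun_prop
  · exact Complex.continuous_conj.comp (continuous_apply _)
  · fun_prop

/-- The Fourier-Wiener series converges unconditionally in `L²`, almost surely. -/
lemma ae_summable_loop : ∀ᵐ ω ∂gaussianNoise, Summable fun n : ℤ =>
    (gaussianCoeff ω n / ((|n| : ℤ) : ℂ)) • (fourierLp 2 n : L2Torus) := by
  have hfin : ∫⁻ ω, ∑' n : ℤ, ‖gaussianCoeff ω n / ((|n| : ℤ) : ℂ)‖ₑ ^ 2 ∂gaussianNoise ≠ ∞ := by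
    rw [lintegral_tsum (fun n => by
      have := (continuous_gaussianCoeff n).measurable
      fun_prop)]
    have hb : ∀ n : ℤ, ∫⁻ ω, ‖gaussianCoeff ω n / ((|n| : ℤ) : ℂ)‖ₑ ^ 2 ∂gaussianNoise ≤
        ENNReal.ofReal (1 / (n : ℝ) ^ 2) * ∫⁻ z, ‖z‖ₑ ^ 2 ∂stdComplexGaussian := by
      intro n
      have hE : ∀ ω, ‖gaussianCoeff ω n / ((|n| : ℤ) : ℂ)‖ₑ ^ 2 =
          ENNReal.ofReal (1 / (n : ℝ) ^ 2) * ‖gaussianCoeff ω n‖ₑ ^ 2 := by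
        intro ω
        rw [← ofReal_norm, ← ofReal_norm, ← ENNReal.ofReal_pow (by positivity),
          ← ENNReal.ofReal_pow (by positivity), ← ENNReal.ofReal_mul (by positivity)]
        congr 1
        rw [norm_div, div_pow]
        simp
        ring
      simp_rw [hE]
      rw [lintegral_const_mul' _ _ ENNReal.ofReal_ne_top]
      gcongr
      exact lintegral_sq_gaussianCoeff_le n
    refine ne_top_of_le_ne_top ?_ (ENNReal.tsum_le_tsum hb)
    rw [ENNReal.tsum_mul_right]
    refine ENNReal.mul_ne_top ?_ lintegral_sq_stdComplexGaussian_lt_top.ne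
    exact (Real.summable_one_div_int_pow.mpr (by norm_num)).tsum_ofReal_ne_top
  have hmeas : Measurable fun ω => ∑' n : ℤ, ‖gaussianCoeff ω n / ((|n| : ℤ) : ℂ)‖ₑ ^ 2 := by
    refine Measurable.tsum fun n => ?_
    have := (continuous_gaussianCoeff n).measurable
    fun_prop
  filter_upwards [ae_lt_top hmeas hfin] with ω hω
  have hs : Summable fun n : ℤ => ‖gaussianCoeff ω n / ((|n| : ℤ) : ℂ)‖ ^ 2 := by
    have := ENNReal.summable_toReal hω.ne
    simpa using this
  have := (orthonormal_fourier (T := 2 * Real.pi)).orthogonalFamily.summable_iff_norm_sq_summable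
    (fun n : ℤ => gaussianCoeff ω n / ((|n| : ℤ) : ℂ))
  simpa using this.mpr hs

lemma aemeasurable_loop : AEMeasurable loop gaussianNoise := by
  refine aemeasurable_of_tendsto_metrizable_ae atTop
    (f := fun (A : Finset ℤ) ω => ∑ n ∈ A,
      (gaussianCoeff ω n / ((|n| : ℤ) : ℂ)) • (fourierLp 2 n : L2Torus)) (fun A => ?_) ?_
  · refine Continuous.aemeasurable ?_
    refine continuous_finsetSum _ fun n _ => ?_
    exact ((continuous_gaussianCoeff n).div_const _).smul continuous_const
  · filter_upwards [ae_summable_loop] with ω hω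
    exact hω.hasSum

instance isProbabilityMeasure_wienerMeasure : IsProbabilityMeasure wienerMeasure :=
  Measure.isProbabilityMeasure_map aemeasurable_loop

end BrownianLoop

end

/-!
The proof rests on the fact that, for fixed `x` and `y`, the values `P_N u(x)` and the increments
`P_N u(x) - P_N u(y)` are Gaussian, so that their `L^q` norms are `O(√q)` times their standard
deviations (`momentLE_fourierCoeff_form`). A product of `k` such variables is dominated by the
`k`-th power of a sum of Gaussians, hence its `L^q` norm is `O(q^{k/2})`, and no hypercontractivity
for Wiener chaoses is required.

The loop has `E |P_N u(x + h) - P_N u(x)|² = O(h)` uniformly in `N` at the dyadic steps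
`h_i = π / 2^{i+1}`, hence every polynomial of degree `k` in the partial sums is bounded and
`1/2`-Hölder in `L^q(ρ)` with constant `O(q^{k/2})` (`holderBound_monomial`). By Parseval, the
increment at the step `h_i` dominates the Fourier mass of the block `2^i ≤ |n| < 2^{i+1}`, which
therefore is `O(q^k 2^{-i})`; the blocks sum up to a bound in `H^s` for all `s < 1/2`
(`momentLE_weight_fourierCoeff`, `exists_momentLE_powCoeff`).

For the difference of `F_M(u)` and `F_N(u)`, the frequencies `|n| > N / 2` are treated separately
in each term: they gain `N^{-ε}` over the `H^{s+ε}` norm. At a frequency `|n| ≤ N / 2`, write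
`(P_M u)^k - (P_N u)^k = (P_M u - P_N u) Q`. The first factor only has frequencies above `N`, so
only the frequencies of `Q` above `N / 2` contribute, and Cauchy-Schwarz bounds the Fourier
coefficient by the product of two `L²` tails, each of size `N^{-1/2}`, for `Q` by the bound on its
dyadic blocks. Summing `(1 + n²)^s N^{-2}` over these `n` yields `O(N^{-2ε})` because `ε ≤ 1` and
`s + ε < 1/2` (`exists_momentLE_truncCoeff_sub`).

Finally, the powers of the dyadic partial sums are almost surely Cauchy in `L²(𝕋)`, so `u^k` is
square-integrable and its Fourier coefficients are limits of those of `(P_{2^j} u)^k`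
(`ae_memLp_pow_and_tendsto_powCoeff`); the estimates pass to the limit by Fatou's lemma.
-/

noncomputable section

namespace BrownianLoop

/-! ### Moment bounds -/

section Moments

variable {Ω : Type*} [MeasurableSpace Ω] {μ : Measure Ω}

/-- The moment bound `‖X‖_{L^r(μ)} ≤ b` for a nonnegative random variable `X` and an integer `r`,
written without roots. -/
def MomentLE (μ : Measure Ω) (r : ℕ) (X : Ω → ℝ≥0∞) (b : ℝ≥0∞) : Prop :=
  ∫⁻ ω, X ω ^ r ∂μ ≤ b ^ r

lemma momentLE_iff {r : ℕ} (hr : r ≠ 0) {X : Ω → ℝ≥0∞} {b : ℝ≥0∞} :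
    MomentLE μ r X b ↔ (∫⁻ ω, X ω ^ (r : ℝ) ∂μ) ^ (1 / (r : ℝ)) ≤ b := by
  have hr' : (0 : ℝ) < r := by positivity
  rw [one_div, ENNReal.rpow_inv_le_iff hr']
  simp [MomentLE]

namespace MomentLE

lemma mono {r : ℕ} {X Y : Ω → ℝ≥0∞} {b c : ℝ≥0∞} (h : MomentLE μ r X b)
    (hXY : ∀ ω, Y ω ≤ X ω) (hbc : b ≤ c) : MomentLE μ r Y c := by
  unfold MomentLE at *
  calc ∫⁻ ω, Y ω ^ r ∂μ ≤ ∫⁻ ω, X ω ^ r ∂μ := by gcongr with ω; exact hXY ω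
    _ ≤ b ^ r := h
    _ ≤ c ^ r := by gcongr

lemma mono_ae {r : ℕ} {X Y : Ω → ℝ≥0∞} {b c : ℝ≥0∞} (h : MomentLE μ r X b)
    (hXY : ∀ᵐ ω ∂μ, Y ω ≤ X ω) (hbc : b ≤ c) : MomentLE μ r Y c := by
  unfold MomentLE at *
  calc ∫⁻ ω, Y ω ^ r ∂μ ≤ ∫⁻ ω, X ω ^ r ∂μ := by
        refine lintegral_mono_ae ?_
        filter_upwards [hXY] with ω hω
        gcongr
    _ ≤ b ^ r := h
    _ ≤ c ^ r := by gcongr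

lemma pow {r k : ℕ} {X : Ω → ℝ≥0∞} {b : ℝ≥0∞} (h : MomentLE μ (k * r) X b) :
    MomentLE μ r (fun ω => X ω ^ k) (b ^ k) := by
  simpa [MomentLE, ← pow_mul] using h

lemma const_mul {r : ℕ} {X : Ω → ℝ≥0∞} {b : ℝ≥0∞} (h : MomentLE μ r X b)
    (hX : AEMeasurable X μ) (c : ℝ≥0∞) :
    MomentLE μ r (fun ω => c * X ω) (c * b) := by
  unfold MomentLE at *
  simp_rw [mul_pow]
  rw [lintegral_const_mul'' _ (hX.pow_const r)]
  gcongr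

lemma add {r : ℕ} (hr : r ≠ 0) {X Y : Ω → ℝ≥0∞} {b c : ℝ≥0∞} (hX : MomentLE μ r X b)
    (hY : MomentLE μ r Y c) (mX : AEMeasurable X μ) (mY : AEMeasurable Y μ) :
    MomentLE μ r (fun ω => X ω + Y ω) (b + c) := by
  rw [momentLE_iff hr] at *
  have h1 : (1 : ℝ) ≤ r := by exact_mod_cast Nat.one_le_iff_ne_zero.mpr hr
  exact (ENNReal.lintegral_Lp_add_le mX mY h1).trans (add_le_add hX hY)

lemma sum {r : ℕ} (hr : r ≠ 0) {ι : Type*} (S : Finset ι) {X : ι → Ω → ℝ≥0∞} {b : ι → ℝ≥0∞}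
    (hX : ∀ i ∈ S, MomentLE μ r (X i) (b i)) (mX : ∀ i ∈ S, AEMeasurable (X i) μ) :
    MomentLE μ r (fun ω => ∑ i ∈ S, X i ω) (∑ i ∈ S, b i) := by
  classical
  induction S using Finset.induction_on with
  | empty => simp [MomentLE, hr]
  | insert a S ha ih =>
    simp only [Finset.sum_insert ha]
    refine add hr (hX a (by simp)) (ih (fun i hi => hX i (by simp [hi]))
      (fun i hi => mX i (by simp [hi]))) (mX a (by simp)) ?_
    exact Finset.aemeasurable_fun_sum S fun i hi => mX i (by simp [hi])

/-- Fatou's lemma for moment bounds. -/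
lemma of_le_liminf {r : ℕ} {X : ℕ → Ω → ℝ≥0∞} {Y : Ω → ℝ≥0∞} {b : ℝ≥0∞}
    (hX : ∀ j, MomentLE μ r (X j) b) (mX : ∀ j, AEMeasurable (X j) μ)
    (hY : ∀ᵐ ω ∂μ, Y ω ≤ liminf (fun j => X j ω) atTop) : MomentLE μ r Y b := by
  unfold MomentLE at *
  calc ∫⁻ ω, Y ω ^ r ∂μ ≤ ∫⁻ ω, liminf (fun j => X j ω ^ r) atTop ∂μ := by
        refine lintegral_mono_ae ?_
        filter_upwards [hY] with ω hω
        have := (pow_left_mono r : Monotone fun a : ℝ≥0∞ => a ^ r).map_liminf_of_continuousAt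
          (F := atTop) (fun j => X j ω) (ENNReal.continuous_pow r).continuousAt
        calc Y ω ^ r ≤ (liminf (fun j => X j ω) atTop) ^ r := by gcongr
          _ = _ := this
    _ ≤ liminf (fun j => ∫⁻ ω, X j ω ^ r ∂μ) atTop :=
        lintegral_liminf_le' fun j => (mX j).pow_const r
    _ ≤ b ^ r := by
        refine liminf_le_of_le (by isBoundedDefault) fun a ha => ?_
        obtain ⟨j, hj⟩ := ha.exists
        exact hj.trans (hX j)

/-- Minkowski's inequality for series. -/
lemma tsum {r : ℕ} (hr : r ≠ 0) {X : ℕ → Ω → ℝ≥0∞} {b : ℕ → ℝ≥0∞}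
    (hX : ∀ i, MomentLE μ r (X i) (b i)) (mX : ∀ i, AEMeasurable (X i) μ) :
    MomentLE μ r (fun ω => ∑' i, X i ω) (∑' i, b i) := by
  refine of_le_liminf (X := fun N ω => ∑ i ∈ Finset.range N, X i ω) (fun N => ?_) (fun N => ?_) ?_
  · exact (sum hr _ (fun i _ => hX i) (fun i _ => mX i)).mono (fun _ => le_rfl)
      (ENNReal.sum_le_tsum _)
  · exact Finset.aemeasurable_fun_sum _ fun i _ => mX i
  · refine Eventually.of_forall fun ω => ?_
    exact (ENNReal.tendsto_nat_tsum fun i => X i ω).liminf_eq.ge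

/-- The average of random variables with a common moment bound satisfies the same bound
(Jensen's inequality). -/
lemma average [SFinite μ] {r : ℕ} (hr : r ≠ 0) {T : Type*} [MeasurableSpace T] {ν : Measure T}
    [IsProbabilityMeasure ν] {X : Ω → T → ℝ≥0∞} (mX : Measurable (Function.uncurry X)) {b : ℝ≥0∞}
    (hX : ∀ x, MomentLE μ r (fun ω => X ω x) b) :
    MomentLE μ r (fun ω => ∫⁻ x, X ω x ∂ν) b := by
  unfold MomentLE at *
  have h1 : (1 : ℝ) ≤ r := by exact_mod_cast Nat.one_le_iff_ne_zero.mpr hr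
  calc ∫⁻ ω, (∫⁻ x, X ω x ∂ν) ^ r ∂μ ≤ ∫⁻ ω, ∫⁻ x, X ω x ^ r ∂ν ∂μ := by
        refine lintegral_mono fun ω => ?_
        have hm : AEStronglyMeasurable (X ω) ν :=
          (mX.of_uncurry_left).aestronglyMeasurable
        have := eLpNorm'_le_eLpNorm'_of_exponent_le (μ := ν) one_pos h1 hm
        simp only [eLpNorm', one_div, enorm_eq_self] at this
        rw [ENNReal.le_rpow_inv_iff (by linarith)] at this
        simpa using this
    _ = ∫⁻ x, ∫⁻ ω, X ω x ^ r ∂μ ∂ν := by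
        refine lintegral_lintegral_swap ?_
        exact (mX.pow_const r).aemeasurable
    _ ≤ ∫⁻ x, b ^ r ∂ν := lintegral_mono fun x => hX x
    _ = b ^ r := by simp

lemma mul {r : ℕ} {X Y : Ω → ℝ≥0∞} {b c : ℝ≥0∞}
    (hX : MomentLE μ (2 * r) X b) (hY : MomentLE μ (2 * r) Y c) (mX : AEMeasurable X μ)
    (mY : AEMeasurable Y μ) : MomentLE μ r (fun ω => X ω * Y ω) (b * c) := by
  unfold MomentLE at *
  have h := ENNReal.lintegral_mul_le_Lp_mul_Lq μ Real.HolderConjugate.two_two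
    (mX.pow_const r) (mY.pow_const r)
  calc ∫⁻ ω, (X ω * Y ω) ^ r ∂μ = ∫⁻ ω, ((fun ω => X ω ^ r) * (fun ω => Y ω ^ r)) ω ∂μ := by
        simp [mul_pow]
    _ ≤ _ := h
    _ ≤ (b ^ (2 * r)) ^ (1 / 2 : ℝ) * (c ^ (2 * r)) ^ (1 / 2 : ℝ) := by
        gcongr
        · simpa [← pow_mul, mul_comm] using hX
        · simpa [← pow_mul, mul_comm] using hY
    _ = (b * c) ^ r := by
        have : ∀ a : ℝ≥0∞, (a ^ (2 * r)) ^ (1 / 2 : ℝ) = a ^ r := fun a => by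
          rw [← ENNReal.rpow_natCast, ← ENNReal.rpow_mul, ← ENNReal.rpow_natCast]
          congr 1; push_cast; ring
        rw [this, this, mul_pow]

end MomentLE

end Moments

/-! ### Moments of Gaussian linear forms -/

section Gauss

/-- A real linear form in the Gaussian noise. -/
def realForm (α β : ℕ → ℝ) (S : Finset ℕ) (ω : ℕ → ℂ) : ℝ :=
  ∑ n ∈ S, (α n * (ω n).re + β n * (ω n).im)

lemma measurable_realForm (α β : ℕ → ℝ) (S : Finset ℕ) : Measurable (realForm α β S) := by
  unfold realForm
  fun_prop

lemma integrable_exp_and_mgf_stdComplexGaussian (a b t : ℝ) :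
    Integrable (fun z : ℂ => Real.exp (t * (a * z.re + b * z.im))) stdComplexGaussian ∧
    mgf (fun z : ℂ => a * z.re + b * z.im) stdComplexGaussian t
      = Real.exp (t ^ 2 * (a ^ 2 + b ^ 2) / 4) := by
  have hm : Measurable fun q : ℝ × ℝ => (q.1 : ℂ) + (q.2 : ℂ) * Complex.I := by fun_prop
  have hf : Measurable (fun z : ℂ => Real.exp (t * (a * z.re + b * z.im))) := by fun_prop
  have hsplit : ∀ q : ℝ × ℝ, Real.exp (t * (a * ((q.1 : ℂ) + (q.2 : ℂ) * Complex.I).re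
      + b * ((q.1 : ℂ) + (q.2 : ℂ) * Complex.I).im))
      = Real.exp ((t * a) * q.1) * Real.exp ((t * b) * q.2) := fun q => by
    rw [← Real.exp_add]; congr 1; simp; ring
  have h1 : ∀ c : ℝ, ∫ x, Real.exp (c * x) ∂(gaussianReal 0 (1 / 2)) = Real.exp (c ^ 2 / 4) := by
    intro c
    have := congrFun (mgf_id_gaussianReal (μ := 0) (v := 1 / 2)) c
    simp only [mgf, id] at this
    rw [this]
    congr 1
    push_cast
    ring
  have h2 : ∀ c : ℝ, Integrable (fun x => Real.exp (c * x)) (gaussianReal 0 (1 / 2)) :=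
    fun c => integrable_exp_mul_gaussianReal c
  constructor
  · rw [stdComplexGaussian, integrable_map_measure hf.aestronglyMeasurable hm.aemeasurable]
    simp only [Function.comp_def, hsplit]
    exact (h2 _).mul_prod (h2 _)
  · rw [mgf, stdComplexGaussian, integral_map hm.aemeasurable hf.aestronglyMeasurable]
    simp only [hsplit]
    rw [integral_prod_mul (fun x => Real.exp (t * a * x)) (fun y => Real.exp (t * b * y)),
      h1, h1, ← Real.exp_add]
    congr 1; ring

lemma integrable_exp_and_mgf_realForm (α β : ℕ → ℝ) (S : Finset ℕ) (t : ℝ) :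
    Integrable (fun ω => Real.exp (t * realForm α β S ω)) gaussianNoise ∧
    mgf (realForm α β S) gaussianNoise t
      = Real.exp (t ^ 2 * (∑ n ∈ S, (α n ^ 2 + β n ^ 2)) / 4) := by
  have hmp := fun n : ℕ => measurePreserving_eval_infinitePi (fun _ : ℕ => stdComplexGaussian) n
  have hind : iIndepFun (fun n (ω : ℕ → ℂ) => α n * (ω n).re + β n * (ω n).im) gaussianNoise :=
    iIndepFun_infinitePi (P := fun _ : ℕ => stdComplexGaussian)
      (X := fun n z => α n * z.re + β n * z.im) (fun n => by fun_prop)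
  have hmeas : ∀ n, Measurable (fun (ω : ℕ → ℂ) => α n * (ω n).re + β n * (ω n).im) :=
    fun n => by fun_prop
  have hform : realForm α β S
      = ∑ n ∈ S, (fun (ω : ℕ → ℂ) => α n * (ω n).re + β n * (ω n).im) := by
    ext ω; simp [realForm]
  constructor
  · have := hind.integrable_exp_mul_sum (t := t) hmeas (s := S) (fun n _ =>
      (hmp n).integrable_comp_of_integrable
        (integrable_exp_and_mgf_stdComplexGaussian (α n) (β n) t).1)
    rw [hform]
    exact this
  · rw [hform, hind.mgf_sum hmeas S]
    have : ∀ n, mgf (fun (ω : ℕ → ℂ) => α n * (ω n).re + β n * (ω n).im) gaussianNoise t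
        = Real.exp (t ^ 2 * (α n ^ 2 + β n ^ 2) / 4) := fun n => by
      rw [← (integrable_exp_and_mgf_stdComplexGaussian (α n) (β n) t).2, mgf, mgf,
        ← (hmp n).map_eq, integral_map (hmp n).measurable.aemeasurable
          (Measurable.aestronglyMeasurable (by fun_prop))]
      rfl
    simp only [this]
    rw [← Real.exp_sum]
    congr 1
    rw [Finset.mul_sum, Finset.sum_div]

/-- A real Gaussian form of variance at most `v²` has `L^{2q}` norm `O(√q v)`: compare
`x^{2q}` with `(2q)! (e^{tx} + e^{-tx}) / t^{2q}` at `t = √(2q) / v`. -/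
lemma momentLE_realForm (α β : ℕ → ℝ) (S : Finset ℕ) {v : ℝ} (hv : 0 < v)
    (h : ∑ n ∈ S, (α n ^ 2 + β n ^ 2) ≤ v ^ 2) {q : ℕ} (hq : 1 ≤ q) :
    MomentLE gaussianNoise (2 * q) (fun ω => ‖realForm α β S ω‖ₑ)
      (ENNReal.ofReal (4 * √((2 * q : ℕ) : ℝ) * v)) := by
  set r := 2 * q with hr
  have hr0 : (0 : ℝ) < (r : ℝ) := by simp [hr]; omega
  set t : ℝ := √(r : ℝ) / v with ht
  have ht0 : 0 < t := by positivity
  set X := realForm α β S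
  have hpt : ∀ ω, |X ω| ^ r ≤ (r.factorial : ℝ) / t ^ r
      * (Real.exp (t * X ω) + Real.exp ((-t) * X ω)) := by
    intro ω
    have h1 := Real.pow_div_factorial_le_exp (t * |X ω|) (by positivity) r
    have h2 : Real.exp (t * |X ω|) ≤ Real.exp (t * X ω) + Real.exp ((-t) * X ω) := by
      rcases abs_cases (X ω) with ⟨h, _⟩ | ⟨h, _⟩ <;> rw [h]
      · linarith [Real.exp_pos ((-t) * X ω)]
      · rw [mul_neg, ← neg_mul]; linarith [Real.exp_pos (t * X ω)]
    have hf : (0 : ℝ) < r.factorial := by positivity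
    have h3 := h1.trans h2
    rw [div_le_iff₀ hf, mul_pow] at h3
    rw [div_mul_eq_mul_div, le_div_iff₀ (by positivity)]
    linarith
  have hbound : ∀ τ : ℝ, τ ^ 2 = t ^ 2 → mgf X gaussianNoise τ ≤ Real.exp q := by
    intro τ hτ
    rw [(integrable_exp_and_mgf_realForm α β S τ).2, hτ]
    refine Real.exp_le_exp.mpr ?_
    have : t ^ 2 * v ^ 2 = r := by
      rw [ht, div_pow, Real.sq_sqrt hr0.le]; field_simp
    calc t ^ 2 * (∑ n ∈ S, (α n ^ 2 + β n ^ 2)) / 4 ≤ t ^ 2 * v ^ 2 / 4 := by gcongr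
      _ ≤ (q : ℝ) := by rw [this, hr]; push_cast; linarith [Nat.cast_nonneg (α := ℝ) q]
  have hint := fun τ => (integrable_exp_and_mgf_realForm α β S τ).1
  have hfin : (r.factorial : ℝ) / t ^ r * (2 * Real.exp q) ≤ (4 * √(r : ℝ) * v) ^ r := by
    have e1 : (r.factorial : ℝ) ≤ (r : ℝ) ^ r := by exact_mod_cast Nat.factorial_le_pow r
    have e2 : (r : ℝ) ^ r / t ^ r = (√(r : ℝ) * v) ^ r := by
      rw [← div_pow]; congr 1
      rw [ht, div_div_eq_mul_div, div_eq_iff (by positivity)]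
      nlinarith [Real.mul_self_sqrt hr0.le]
    have e3 : 2 * Real.exp q ≤ 4 ^ r := by
      have : Real.exp 1 ≤ 3 := by linarith [Real.exp_one_lt_d9]
      calc 2 * Real.exp q = 2 * (Real.exp 1) ^ q := by rw [← Real.exp_nat_mul]; simp
        _ ≤ 2 ^ q * 3 ^ q := by
          gcongr
          exact le_self_pow₀ (by norm_num) (by omega)
        _ = 6 ^ q := by rw [← mul_pow]; norm_num
        _ ≤ 16 ^ q := by gcongr; norm_num
        _ = 4 ^ r := by rw [hr, pow_mul]; norm_num
    calc (r.factorial : ℝ) / t ^ r * (2 * Real.exp q)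
        ≤ (r : ℝ) ^ r / t ^ r * 4 ^ r := by gcongr
      _ = (4 * √(r : ℝ) * v) ^ r := by rw [e2, ← mul_pow]; congr 1; ring
  unfold MomentLE
  calc ∫⁻ ω, ‖X ω‖ₑ ^ r ∂gaussianNoise
      ≤ ∫⁻ ω, ENNReal.ofReal ((r.factorial : ℝ) / t ^ r
        * (Real.exp (t * X ω) + Real.exp ((-t) * X ω))) ∂gaussianNoise := by
        refine lintegral_mono fun ω => ?_
        rw [← ofReal_norm, ← ENNReal.ofReal_pow (by positivity)]
        exact ENNReal.ofReal_le_ofReal (hpt ω)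
    _ = ENNReal.ofReal (∫ ω, (r.factorial : ℝ) / t ^ r
        * (Real.exp (t * X ω) + Real.exp ((-t) * X ω)) ∂gaussianNoise) := by
        rw [ofReal_integral_eq_lintegral_ofReal]
        · exact ((hint t).add (hint (-t))).const_mul _
        · exact Eventually.of_forall fun ω => by positivity
    _ ≤ ENNReal.ofReal ((4 * √(r : ℝ) * v) ^ r) := by
        refine ENNReal.ofReal_le_ofReal (le_trans ?_ hfin)
        rw [integral_const_mul, integral_add (hint t) (hint (-t))]
        have b1 := hbound t rfl
        have b2 := hbound (-t) (by ring)
        rw [mgf] at b1 b2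
        gcongr
        linarith
    _ = _ := ENNReal.ofReal_pow (by positivity) _

end Gauss

section WienerForms

/-- The Fourier coefficients of the Fourier-Wiener series. -/
def loopCoeff (ω : ℕ → ℂ) (n : ℤ) : ℂ := gaussianCoeff ω n / ((|n| : ℤ) : ℂ)

lemma loopCoeff_of_pos {n : ℤ} (hn : 0 < n) (ω : ℕ → ℂ) :
    loopCoeff ω n = (n : ℂ)⁻¹ * ω n.natAbs := by
  simp [loopCoeff, gaussianCoeff, hn, abs_of_pos hn, div_eq_inv_mul]

lemma loopCoeff_of_neg {n : ℤ} (hn : n < 0) (ω : ℕ → ℂ) :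
    loopCoeff ω n = -(n : ℂ)⁻¹ * starRingEnd ℂ (ω n.natAbs) := by
  simp [loopCoeff, gaussianCoeff, hn, hn.le, abs_of_neg hn, div_eq_inv_mul]

lemma loopCoeff_zero (ω : ℕ → ℂ) : loopCoeff ω 0 = 0 := by
  simp [loopCoeff]

/-- A complex linear form in independent Gaussians `z` and, when `σ = -1`, in their conjugates. -/
lemma momentLE_signedForm (σ : ℝ) (hσ : σ ^ 2 = 1) (d : ℕ → ℂ) (S : Finset ℕ) {v : ℝ}
    (hv : 0 < v) (h : ∑ n ∈ S, ‖d n‖ ^ 2 ≤ v ^ 2) {q : ℕ} (hq : 1 ≤ q) :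
    MomentLE gaussianNoise (2 * q)
      (fun ω => ‖∑ n ∈ S, d n * ((ω n).re + σ * (ω n).im * Complex.I)‖ₑ)
      (ENNReal.ofReal (8 * √((2 * q : ℕ) : ℝ) * v)) := by
  have hd : ∀ n, ‖d n‖ ^ 2 = (d n).re ^ 2 + (d n).im ^ 2 := fun n => by
    rw [Complex.sq_norm, Complex.normSq_apply]; ring
  simp only [hd] at h
  have h1 := momentLE_realForm (fun n => (d n).re) (fun n => -(σ * (d n).im)) S hv
    (by simpa [mul_pow, hσ] using h) hq
  have h2 := momentLE_realForm (fun n => (d n).im) (fun n => σ * (d n).re) S hv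
    (by simpa [mul_pow, hσ, add_comm] using h) hq
  refine (h1.add (by omega) h2 (measurable_realForm _ _ _).enorm.aemeasurable
    (measurable_realForm _ _ _).enorm.aemeasurable).mono (fun ω => ?_) ?_
  · set z : ℂ := ∑ n ∈ S, d n * (((ω n).re : ℂ) + σ * (ω n).im * Complex.I) with hz
    have hre : z.re = realForm (fun n => (d n).re) (fun n => -(σ * (d n).im)) S ω := by
      simp only [hz, realForm, Complex.re_sum]
      refine Finset.sum_congr rfl fun n _ => ?_
      simp
      ring
    have him : z.im = realForm (fun n => (d n).im) (fun n => σ * (d n).re) S ω := by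
      simp only [hz, realForm, Complex.im_sum]
      refine Finset.sum_congr rfl fun n _ => ?_
      simp
      ring
    rw [← hre, ← him, ← ofReal_norm, ← ofReal_norm, ← ofReal_norm,
      ← ENNReal.ofReal_add (by positivity) (by positivity)]
    exact ENNReal.ofReal_le_ofReal (Complex.norm_le_abs_re_add_abs_im z)
  · rw [← ENNReal.ofReal_add (by positivity) (by positivity)]
    exact ENNReal.ofReal_le_ofReal (by linarith)

/-- Linear forms in the coefficients `g_n / |n|`. As `g_{-n}` is the conjugate of `g_n`, the
positive and the negative frequencies are each a form in independent variables, but not jointly. -/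
lemma momentLE_loopCoeff_form (c : ℤ → ℂ) (S : Finset ℤ) {v : ℝ} (hv : 0 < v)
    (h : ∑ n ∈ S, ‖c n‖ ^ 2 / (n : ℝ) ^ 2 ≤ v ^ 2) {q : ℕ} (hq : 1 ≤ q) :
    MomentLE gaussianNoise (2 * q) (fun ω => ‖∑ n ∈ S, c n * loopCoeff ω n‖ₑ)
      (ENNReal.ofReal (16 * √((2 * q : ℕ) : ℝ) * v)) := by
  classical
  set Sp := S.filter (0 < ·)
  set Sn := S.filter (· < 0)
  have hsplit : ∀ ω, ∑ n ∈ S, c n * loopCoeff ω n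
      = ∑ n ∈ Sp, c n * loopCoeff ω n + ∑ n ∈ Sn, c n * loopCoeff ω n := by
    intro ω
    rw [Finset.sum_filter, Finset.sum_filter, ← Finset.sum_add_distrib]
    refine Finset.sum_congr rfl fun n _ => ?_
    rcases lt_trichotomy n 0 with h | h | h
    · simp [h, h.le]
    · simp [h, loopCoeff_zero]
    · simp [h, h.le]
  have hp : ∀ ω, ∑ n ∈ Sp, c n * loopCoeff ω n = ∑ m ∈ Sp.image Int.natAbs,
      (c m * (m : ℂ)⁻¹) * ((ω m).re + (1 : ℝ) * (ω m).im * Complex.I) := by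
    intro ω
    rw [Finset.sum_image]
    · refine Finset.sum_congr rfl fun n hn => ?_
      have hn : 0 < n := (Finset.mem_filter.mp hn).2
      have e : ((n.natAbs : ℕ) : ℤ) = n := by omega
      have e' : ((n.natAbs : ℕ) : ℂ) = n := by
        rw [← Int.cast_natCast, e]
      rw [loopCoeff_of_pos hn, e, e']
      conv_lhs => rw [← Complex.re_add_im (ω n.natAbs)]
      push_cast; ring
    · intro a ha b hb hab
      have := (Finset.mem_filter.mp ha).2
      have := (Finset.mem_filter.mp hb).2
      omega
  have hn : ∀ ω, ∑ n ∈ Sn, c n * loopCoeff ω n = ∑ m ∈ Sn.image Int.natAbs,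
      (c (-m) * (m : ℂ)⁻¹) * ((ω m).re + (-1 : ℝ) * (ω m).im * Complex.I) := by
    intro ω
    rw [Finset.sum_image]
    · refine Finset.sum_congr rfl fun n hn => ?_
      have hn : n < 0 := (Finset.mem_filter.mp hn).2
      have e : -((n.natAbs : ℕ) : ℤ) = n := by omega
      have e' : ((n.natAbs : ℕ) : ℂ) = -n := by
        have : ((n.natAbs : ℕ) : ℤ) = -n := by omega
        rw [← Int.cast_natCast, this]; push_cast; rfl
      rw [loopCoeff_of_neg hn, e, e']
      have hc : starRingEnd ℂ (ω n.natAbs)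
          = ((ω n.natAbs).re : ℂ) - (ω n.natAbs).im * Complex.I := by
        apply Complex.ext <;> simp
      rw [hc, inv_neg]; push_cast; ring
    · intro a ha b hb hab
      have := (Finset.mem_filter.mp ha).2
      have := (Finset.mem_filter.mp hb).2
      omega
  have hsub : ∀ A ⊆ S, ∑ n ∈ A, ‖c n‖ ^ 2 / (n : ℝ) ^ 2 ≤ v ^ 2 := fun A hA =>
    (Finset.sum_le_sum_of_subset_of_nonneg hA fun _ _ _ => by positivity).trans h
  have h1 := momentLE_signedForm 1 (by norm_num) (fun m => c m * (m : ℂ)⁻¹)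
    (Sp.image Int.natAbs) hv (by
      rw [Finset.sum_image]
      · refine le_of_eq_of_le (Finset.sum_congr rfl fun n hn => ?_)
          (hsub Sp (Finset.filter_subset _ _))
        have hn : 0 < n := (Finset.mem_filter.mp hn).2
        have e : ((n.natAbs : ℕ) : ℤ) = n := by omega
        rw [e, ← Int.cast_natCast, e]
        simp [mul_pow, div_eq_mul_inv]
      · intro a ha b hb hab
        have := (Finset.mem_filter.mp ha).2
        have := (Finset.mem_filter.mp hb).2
        omega) hq
  have h2 := momentLE_signedForm (-1) (by norm_num) (fun m => c (-m) * (m : ℂ)⁻¹)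
    (Sn.image Int.natAbs) hv (by
      rw [Finset.sum_image]
      · refine le_of_eq_of_le (Finset.sum_congr rfl fun n hn => ?_)
          (hsub Sn (Finset.filter_subset _ _))
        have hn : n < 0 := (Finset.mem_filter.mp hn).2
        have e : ((n.natAbs : ℕ) : ℤ) = -n := by omega
        rw [← Int.cast_natCast, e]
        simp [mul_pow, div_eq_mul_inv]
      · intro a ha b hb hab
        have := (Finset.mem_filter.mp ha).2
        have := (Finset.mem_filter.mp hb).2
        omega) hq
  refine (h1.add (by omega) h2 ?_ ?_).mono (fun ω => ?_) ?_
  · exact (Measurable.enorm (by fun_prop)).aemeasurable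
  · exact (Measurable.enorm (by fun_prop)).aemeasurable
  · rw [hsplit, hp, hn]
    exact enorm_add_le _ _
  · rw [← ENNReal.ofReal_add (by positivity) (by positivity)]
    exact ENNReal.ofReal_le_ofReal (by linarith)

lemma continuous_fourierCoeff_L2 (n : ℤ) :
    Continuous fun u : L2Torus => fourierCoeff (u : Torus → ℂ) n := by
  have : (fun u : L2Torus => fourierCoeff (u : Torus → ℂ) n)
      = fun u => inner ℂ (fourierLp 2 n : L2Torus) u := by
    ext u
    rw [← fourierBasis_repr, HilbertBasis.repr_apply_apply, coe_fourierBasis]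
  rw [this]
  exact continuous_const.inner continuous_id

lemma fourierCoeff_loop : ∀ᵐ ω ∂gaussianNoise, ∀ n : ℤ,
    fourierCoeff (loop ω : Torus → ℂ) n = loopCoeff ω n := by
  filter_upwards [ae_summable_loop] with ω hω n
  have h := hω.hasSum.mapL (innerSL ℂ (fourierLp 2 n : L2Torus))
  have h2 : HasSum (fun m : ℤ => innerSL ℂ (fourierLp 2 n : L2Torus)
      ((gaussianCoeff ω m / ((|m| : ℤ) : ℂ)) • (fourierLp 2 m : L2Torus))) (loopCoeff ω n) := by
    convert hasSum_single (f := fun m : ℤ => innerSL ℂ (fourierLp 2 n : L2Torus)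
      ((gaussianCoeff ω m / ((|m| : ℤ) : ℂ)) • (fourierLp 2 m : L2Torus))) n ?_ using 1
    · simp [loopCoeff, (orthonormal_fourier (T := 2 * Real.pi)).1 n]
    · intro m hm
      simp [orthonormal_iff_ite.mp (orthonormal_fourier (T := 2 * Real.pi)) n m, hm.symm]
  rw [← fourierBasis_repr, HilbertBasis.repr_apply_apply, coe_fourierBasis]
  exact h.unique h2

/-- Linear forms in the Fourier coefficients of a Brownian loop: the `L^{2q}` norm is bounded by
`√q` times the standard deviation. -/
lemma momentLE_fourierCoeff_form (c : ℤ → ℂ) (S : Finset ℤ) {v : ℝ} (hv : 0 < v)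
    (h : ∑ n ∈ S, ‖c n‖ ^ 2 / (n : ℝ) ^ 2 ≤ v ^ 2) {q : ℕ} (hq : 1 ≤ q) :
    MomentLE wienerMeasure (2 * q)
      (fun u => ‖∑ n ∈ S, c n * fourierCoeff (u : Torus → ℂ) n‖ₑ)
      (ENNReal.ofReal (16 * √((2 * q : ℕ) : ℝ) * v)) := by
  refine le_of_eq_of_le ?_ (momentLE_loopCoeff_form c S hv h hq)
  rw [wienerMeasure, lintegral_map' _ aemeasurable_loop]
  · refine lintegral_congr_ae ?_
    filter_upwards [fourierCoeff_loop] with ω hω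
    simp only [hω]
  · refine Measurable.aemeasurable ?_
    have := fun n => (continuous_fourierCoeff_L2 n).measurable
    fun_prop

end WienerForms

/-! ### Increments of the partial sums of the loop -/

section Increments

/-- The dyadic step `π / 2^{i+1}`, at which the frequencies of size about `2^i` oscillate. -/
def dyadicStep (i : ℕ) : Torus := ((Real.pi / 2 ^ (i + 1) : ℝ) : AddCircle (2 * Real.pi))

/-- The square root of the dyadic scale `2^{-i}`. -/
def sqrtScale (i : ℕ) : ℝ := √((1 / 2 : ℝ) ^ i)

lemma sqrtScale_sq (i : ℕ) : sqrtScale i ^ 2 = (1 / 2 : ℝ) ^ i :=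
  Real.sq_sqrt (by positivity)

lemma sqrtScale_pos (i : ℕ) : 0 < sqrtScale i := Real.sqrt_pos.mpr (by positivity)

lemma natCast_natAbs_real (n : ℤ) : ((n.natAbs : ℕ) : ℝ) = |(n : ℝ)| := by
  rw [Nat.cast_natAbs, Int.cast_abs]

lemma fourier_add_apply (n : ℤ) (x y : Torus) :
    (fourier n (x + y) : ℂ) = fourier n x * fourier n y := by
  rw [fourier_apply, smul_add, AddCircle.toCircle_add, fourier_apply, fourier_apply]
  push_cast; ring

lemma norm_fourier_dyadicStep_sub_one (i : ℕ) (n : ℤ) :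
    ‖(fourier n (dyadicStep i) : ℂ) - 1‖ = 2 * |Real.sin (n * (Real.pi / 2 ^ (i + 1)) / 2)| := by
  have : (fourier n (dyadicStep i) : ℂ)
      = Complex.exp (Complex.I * ((n * (Real.pi / 2 ^ (i + 1)) : ℝ) : ℂ)) := by
    rw [dyadicStep, fourier_coe_apply]
    congr 1
    have : (Real.pi : ℂ) ≠ 0 := by exact_mod_cast Real.pi_ne_zero
    push_cast
    field_simp
  rw [this, Complex.norm_exp_I_mul_ofReal_sub_one, norm_mul]
  simp

lemma norm_fourier_dyadicStep_sub_one_le (i : ℕ) (n : ℤ) :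
    ‖(fourier n (dyadicStep i) : ℂ) - 1‖ ≤ |(n : ℝ)| * (Real.pi / 2 ^ (i + 1)) := by
  rw [norm_fourier_dyadicStep_sub_one]
  have h := Real.abs_sin_le_abs (x := n * (Real.pi / 2 ^ (i + 1)) / 2)
  rw [abs_div, abs_mul, abs_of_pos (a := Real.pi / 2 ^ (i + 1)) (by positivity)] at h
  simp only [Nat.abs_ofNat] at h
  linarith

lemma norm_fourier_dyadicStep_sub_one_le_two (i : ℕ) (n : ℤ) :
    ‖(fourier n (dyadicStep i) : ℂ) - 1‖ ≤ 2 := by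
  rw [norm_fourier_dyadicStep_sub_one]
  linarith [Real.abs_sin_le_one (n * (Real.pi / 2 ^ (i + 1)) / 2)]

/-- On the dyadic block `2^i ≤ |n| < 2^{i+1}`, the multiplier of the increment of step
`π / 2^{i+1}` is bounded below, as the phase lies between `π / 2` and `π`. -/
lemma one_le_norm_sq_fourier_dyadicStep_sub_one {n : ℤ} (hn : n ≠ 0) :
    1 ≤ ‖(fourier n (dyadicStep (Nat.log 2 n.natAbs)) : ℂ) - 1‖ ^ 2 := by
  set i := Nat.log 2 n.natAbs with hi
  have hn' : n.natAbs ≠ 0 := by omega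
  have l1 : 2 ^ i ≤ n.natAbs := Nat.pow_log_le_self 2 hn'
  have l2 : n.natAbs < 2 ^ (i + 1) := Nat.lt_pow_succ_log_self (by norm_num) _
  have l1' : (2 : ℝ) ^ i ≤ |(n : ℝ)| := by
    rw [← natCast_natAbs_real]; exact_mod_cast l1
  have l2' : |(n : ℝ)| ≤ 2 ^ (i + 1) := by
    rw [← natCast_natAbs_real]; exact_mod_cast l2.le
  rw [norm_fourier_dyadicStep_sub_one]
  set y := |(n : ℝ)| * (Real.pi / 2 ^ (i + 1)) / 2 with hy
  have habs : |Real.sin (n * (Real.pi / 2 ^ (i + 1)) / 2)| = |Real.sin y| := by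
    rw [hy]
    rcases abs_cases (n : ℝ) with ⟨h, _⟩ | ⟨h, _⟩ <;> rw [h]
    rw [show -(n : ℝ) * (Real.pi / 2 ^ (i + 1)) / 2 = -(n * (Real.pi / 2 ^ (i + 1)) / 2) by ring,
      Real.sin_neg, abs_neg]
  have hp : (0 : ℝ) < 2 ^ (i + 1) := by positivity
  have e : y = (|(n : ℝ)| / 2 ^ (i + 1)) * (Real.pi / 2) := by rw [hy]; ring
  have r1 : 1 / 2 ≤ |(n : ℝ)| / 2 ^ (i + 1) := by
    rw [le_div_iff₀ hp, pow_succ]; linarith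
  have r2 : |(n : ℝ)| / 2 ^ (i + 1) ≤ 1 := by
    rw [div_le_one hp]; exact l2'
  have hpi := Real.pi_pos
  have y1 : y ≤ Real.pi / 2 := by rw [e]; nlinarith
  have y0 : 0 ≤ y := by rw [e]; positivity
  -- Jordan's inequality `2 y / π ≤ sin y` gives `sin y ≥ 1 / 2`.
  have hs := Real.mul_le_sin y0 y1
  have : 1 / 2 ≤ Real.sin y := by
    refine le_trans ?_ hs
    rw [e]
    rw [show 2 / Real.pi * (|(n : ℝ)| / 2 ^ (i + 1) * (Real.pi / 2)) = |(n : ℝ)| / 2 ^ (i + 1) by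
      field_simp]
    exact r1
  rw [habs, abs_of_nonneg (by linarith)]
  nlinarith

lemma sum_natAbs_le (S : Finset ℤ) (T : Finset ℕ) (hST : ∀ j ∈ S, j.natAbs ∈ T) (g : ℕ → ℝ)
    (hg : ∀ n, 0 ≤ g n) : ∑ j ∈ S, g j.natAbs ≤ 2 * ∑ n ∈ T, g n := by
  rw [← Finset.sum_fiberwise_of_maps_to hST, Finset.mul_sum]
  refine Finset.sum_le_sum fun n _ => ?_
  have hc : (S.filter (fun j => j.natAbs = n)).card ≤ 2 := by
    refine (Finset.card_le_card (t := {(n : ℤ), -(n : ℤ)}) fun j hj => ?_).trans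
      Finset.card_le_two
    have := (Finset.mem_filter.mp hj).2
    simp only [Finset.mem_insert, Finset.mem_singleton]
    omega
  rw [Finset.sum_congr rfl (g := fun _ => g n)
    (fun j hj => by rw [(Finset.mem_filter.mp hj).2]), Finset.sum_const, nsmul_eq_mul]
  have : ((S.filter (fun j => j.natAbs = n)).card : ℝ) ≤ 2 := by exact_mod_cast hc
  exact mul_le_mul_of_nonneg_right this (hg n)

lemma sum_Ioc_inv_sq_le_inv {N : ℕ} (hN : N ≠ 0) (M : ℕ) :
    ∑ n ∈ Finset.Ioc N M, ((n : ℝ) ^ 2)⁻¹ ≤ (N : ℝ)⁻¹ := by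
  rcases le_total N M with h | h
  · have := sum_Ioc_inv_sq_le_sub (α := ℝ) hN h
    have : (0 : ℝ) ≤ (M : ℝ)⁻¹ := by positivity
    linarith
  · simp [Finset.Ioc_eq_empty_of_le h]

lemma sum_tail_inv_sq_le {N : ℕ} (hN : N ≠ 0) (S : Finset ℤ) (hS : ∀ j ∈ S, N < j.natAbs) :
    ∑ j ∈ S, 1 / (j : ℝ) ^ 2 ≤ (2 : ℝ) / (N : ℝ) := by
  obtain ⟨M, hM⟩ : ∃ M : ℕ, ∀ j ∈ S, j.natAbs ≤ M :=
    ⟨S.sup Int.natAbs, fun j hj => Finset.le_sup (f := Int.natAbs) hj⟩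
  have h := sum_natAbs_le S (Finset.Ioc N M)
    (fun j hj => Finset.mem_Ioc.mpr ⟨hS j hj, hM j hj⟩) (fun n => ((n : ℝ) ^ 2)⁻¹)
    (fun n => by positivity)
  have h2 := sum_Ioc_inv_sq_le_inv hN M
  calc ∑ j ∈ S, 1 / (j : ℝ) ^ 2 = ∑ j ∈ S, (((j.natAbs : ℕ) : ℝ) ^ 2)⁻¹ := by
        refine Finset.sum_congr rfl fun j _ => ?_
        rw [natCast_natAbs_real, sq_abs, one_div]
    _ ≤ (2 : ℝ) / (N : ℝ) := by rw [div_eq_mul_inv]; linarith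

lemma sum_inv_sq_le (S : Finset ℤ) : ∑ j ∈ S, 1 / (j : ℝ) ^ 2 ≤ (4 : ℝ) := by
  rw [← Finset.sum_filter_add_sum_filter_not S (fun j => 1 < j.natAbs)]
  have h1 := sum_tail_inv_sq_le one_ne_zero (S.filter (fun j => 1 < j.natAbs))
    (fun j hj => (Finset.mem_filter.mp hj).2)
  have h2 : ∑ j ∈ S.filter (fun j => ¬ 1 < j.natAbs), 1 / (j : ℝ) ^ 2 ≤ (2 : ℝ) := by
    calc ∑ j ∈ S.filter (fun j => ¬ 1 < j.natAbs), 1 / (j : ℝ) ^ 2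
        ≤ ∑ j ∈ ({-1, 0, 1} : Finset ℤ), 1 / (j : ℝ) ^ 2 := by
          refine Finset.sum_le_sum_of_subset_of_nonneg (fun j hj => ?_)
            (fun _ _ _ => by positivity)
          have := (Finset.mem_filter.mp hj).2
          simp only [Finset.mem_insert, Finset.mem_singleton]
          omega
      _ = 2 := by norm_num
  rw [Nat.cast_one, div_one] at h1
  linarith

/-- The variance of an increment of the loop at the step `π / 2^{i+1}` is `O(2^{-i})`: use
`|e^{ijh} - 1| ≤ 2` for `|j| > 2^i` and `|e^{ijh} - 1| ≤ |j| h` otherwise. -/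
lemma sum_increment_le (i : ℕ) (S : Finset ℤ) :
    ∑ j ∈ S, ‖(fourier j (dyadicStep i) : ℂ) - 1‖ ^ 2 / (j : ℝ) ^ 2 ≤ 16 * (1 / 2) ^ i := by
  have hpi2 : Real.pi ^ 2 ≤ 12 := by nlinarith [Real.pi_lt_d2, Real.pi_pos]
  rw [← Finset.sum_filter_add_sum_filter_not S (fun j => 2 ^ i < j.natAbs)]
  have h1 : ∑ j ∈ S.filter (fun j => 2 ^ i < j.natAbs),
      ‖(fourier j (dyadicStep i) : ℂ) - 1‖ ^ 2 / (j : ℝ) ^ 2 ≤ 8 * (1 / 2) ^ i := by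
    calc _ ≤ ∑ j ∈ S.filter (fun j => 2 ^ i < j.natAbs), 4 * (1 / (j : ℝ) ^ 2) := by
          refine Finset.sum_le_sum fun j _ => ?_
          rw [mul_one_div]
          gcongr
          nlinarith [norm_fourier_dyadicStep_sub_one_le_two i j,
            norm_nonneg ((fourier j (dyadicStep i) : ℂ) - 1)]
      _ ≤ 4 * (2 / ((2 ^ i : ℕ) : ℝ)) := by
          rw [← Finset.mul_sum]
          gcongr
          exact sum_tail_inv_sq_le (pow_ne_zero _ two_ne_zero) _
            (fun j hj => (Finset.mem_filter.mp hj).2)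
      _ = 8 * (1 / 2) ^ i := by
          push_cast
          rw [one_div_pow]
          ring
  have h2 : ∑ j ∈ S.filter (fun j => ¬ 2 ^ i < j.natAbs),
      ‖(fourier j (dyadicStep i) : ℂ) - 1‖ ^ 2 / (j : ℝ) ^ 2 ≤ 8 * (1 / 2) ^ i := by
    set g : ℕ → ℝ := fun n => if n = 0 then 0 else (Real.pi / 2 ^ (i + 1)) ^ 2
    have hg : ∀ n, 0 ≤ g n := fun n => by simp only [g]; split_ifs <;> positivity
    have hT := sum_natAbs_le (S.filter (fun j => ¬ 2 ^ i < j.natAbs)) (Finset.range (2 ^ i + 1))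
      (fun j hj => by
        have := (Finset.mem_filter.mp hj).2
        rw [Finset.mem_range]; omega) g hg
    calc _ ≤ ∑ j ∈ S.filter (fun j => ¬ 2 ^ i < j.natAbs), g j.natAbs := by
          refine Finset.sum_le_sum fun j _ => ?_
          by_cases hj : j = 0
          · simp [hj, g]
          · have hj' : j.natAbs ≠ 0 := by omega
            have hj2 : (0 : ℝ) < (j : ℝ) ^ 2 := by positivity
            simp only [g, hj', if_false]
            rw [div_le_iff₀ hj2, ← sq_abs (j : ℝ), ← mul_pow]
            gcongr
            exact (norm_fourier_dyadicStep_sub_one_le i j).trans_eq (mul_comm _ _)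
      _ ≤ _ := hT
      _ = 2 * (2 ^ i * (Real.pi / 2 ^ (i + 1)) ^ 2) := by
          rw [Finset.sum_range_succ']
          simp [g]
      _ = Real.pi ^ 2 / 2 * (1 / 2) ^ i := by
          rw [one_div_pow, pow_succ]
          field_simp
          ring
      _ ≤ 8 * (1 / 2) ^ i := by gcongr; linarith
  linarith

/-- The partial Fourier sum `P_N u`. -/
def partialSum (N : ℕ) (u : L2Torus) (x : Torus) : ℂ :=
  ∑ j ∈ Finset.Icc (-(N : ℤ)) (N : ℤ), fourierCoeff (u : Torus → ℂ) j * fourier j x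

lemma measurable_partialSum (N : ℕ) : Measurable (Function.uncurry (partialSum N)) := by
  unfold partialSum Function.uncurry
  refine Finset.measurable_fun_sum _ fun j _ => ?_
  exact ((continuous_fourierCoeff_L2 j).measurable.comp measurable_fst).mul
    ((fourier j).continuous.measurable.comp measurable_snd)

lemma measurable_partialSum_left (N : ℕ) (x : Torus) : Measurable fun u => partialSum N u x :=
  Finset.measurable_fun_sum _ fun j _ => (continuous_fourierCoeff_L2 j).measurable.mul_const _

lemma continuous_partialSum (N : ℕ) (u : L2Torus) : Continuous (partialSum N u) := by
  refine continuous_finsetSum _ fun j _ => ?_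
  exact (fourier j).continuous.const_mul _

lemma norm_fourier_apply (n : ℤ) (x : Torus) : ‖(fourier n x : ℂ)‖ = 1 := by
  rw [fourier_apply]; exact Circle.norm_coe _

/-- A bound for the `L^{2q}` norm of a partial sum at a point. The factor `64` also covers the
rescaled increments, whose standard deviation is at most `4` times the root of the scale. -/
def gaussSize (q : ℕ) : ℝ := 64 * √((2 * q : ℕ) : ℝ)

lemma momentLE_partialSum {q : ℕ} (hq : 1 ≤ q) (N : ℕ) (x : Torus) :
    MomentLE wienerMeasure (2 * q) (fun u => ‖partialSum N u x‖ₑ)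
      (ENNReal.ofReal (gaussSize q)) := by
  have h := momentLE_fourierCoeff_form (fun j => fourier j x) (Finset.Icc (-(N : ℤ)) N)
    (v := 2) (by norm_num) (by
      simp only [norm_fourier_apply, one_pow]
      exact (sum_inv_sq_le _).trans (by norm_num)) hq
  refine h.mono (fun u => ?_) (ENNReal.ofReal_le_ofReal ?_)
  · simp only [partialSum, mul_comm]; rfl
  · unfold gaussSize; linarith [Real.sqrt_nonneg ((2 * q : ℕ) : ℝ)]

lemma momentLE_partialSum_increment {q : ℕ} (hq : 1 ≤ q) (N i : ℕ) (x : Torus) :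
    MomentLE wienerMeasure (2 * q)
      (fun u => ‖partialSum N u (x + dyadicStep i) - partialSum N u x‖ₑ)
      (ENNReal.ofReal (gaussSize q * sqrtScale i)) := by
  have hf : ∀ j : ℤ, (fourier j (x + dyadicStep i) : ℂ) - fourier j x
      = fourier j x * (fourier j (dyadicStep i) - 1) := fun j => by
    rw [fourier_add_apply]; ring
  have h := momentLE_fourierCoeff_form
    (fun j => (fourier j (x + dyadicStep i) : ℂ) - fourier j x) (Finset.Icc (-(N : ℤ)) N)
    (v := 4 * sqrtScale i) (by linarith [sqrtScale_pos i]) (by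
      simp only [hf, norm_mul, norm_fourier_apply, one_mul]
      rw [mul_pow, sqrtScale_sq]
      exact (sum_increment_le i _).trans (by norm_num)) hq
  refine h.mono (fun u => ?_) (ENNReal.ofReal_le_ofReal ?_)
  · simp only [partialSum, ← Finset.sum_sub_distrib, ← mul_sub, mul_comm]
    rfl
  · unfold gaussSize; linarith

lemma partialSum_sub {N M : ℕ} (h : N ≤ M) (u : L2Torus) (x : Torus) :
    partialSum M u x - partialSum N u x
      = ∑ j ∈ Finset.Icc (-(M : ℤ)) M \ Finset.Icc (-(N : ℤ)) N,
          fourierCoeff (u : Torus → ℂ) j * fourier j x := by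
  have hs : Finset.Icc (-(N : ℤ)) N ⊆ Finset.Icc (-(M : ℤ)) M :=
    Finset.Icc_subset_Icc (by omega) (by omega)
  rw [partialSum, partialSum, ← Finset.sum_sdiff hs, add_sub_cancel_right]

lemma lt_natAbs_of_mem_sdiff {N M : ℕ} {j : ℤ}
    (hj : j ∈ Finset.Icc (-(M : ℤ)) M \ Finset.Icc (-(N : ℤ)) N) : N < j.natAbs := by
  simp only [Finset.mem_sdiff, Finset.mem_Icc] at hj
  omega

lemma momentLE_partialSum_sub {q : ℕ} (hq : 1 ≤ q) {N M : ℕ} (hN : 1 ≤ N) (h : N ≤ M)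
    (x : Torus) :
    MomentLE wienerMeasure (2 * q)
      (fun u => ‖partialSum M u x - partialSum N u x‖ₑ)
      (ENNReal.ofReal (gaussSize q * √(1 / N))) := by
  have hN' : (0 : ℝ) < N := by exact_mod_cast hN
  have h := momentLE_fourierCoeff_form (fun j => fourier j x)
    (Finset.Icc (-(M : ℤ)) M \ Finset.Icc (-(N : ℤ)) N)
    (v := 2 * √(1 / N)) (by positivity) (by
      simp only [norm_fourier_apply, one_pow]
      refine (sum_tail_inv_sq_le (N := N) (by omega) _
        (fun j hj => lt_natAbs_of_mem_sdiff hj)).trans ?_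
      rw [mul_pow, Real.sq_sqrt (by positivity), ← mul_one_div]
      gcongr; norm_num) hq
  refine h.mono (fun u => ?_) (ENNReal.ofReal_le_ofReal ?_)
  · rw [partialSum_sub ‹_›]
    simp only [mul_comm]; rfl
  · unfold gaussSize
    have : 0 ≤ √((2 * q : ℕ) : ℝ) * √(1 / (N : ℝ)) := by positivity
    linarith

end Increments

/-! ### Weighted Fourier sums and dyadic increments -/

section Blocks

lemma tsum_enorm_sq_fourierCoeff {f : Torus → ℂ} (hf : MemLp f 2 torusMeasure) :
    ∑' n : ℤ, ‖fourierCoeff f n‖ₑ ^ 2 = ∫⁻ x, ‖f x‖ₑ ^ 2 ∂torusMeasure := by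
  have hc : ∀ n, fourierCoeff (hf.toLp f : Torus → ℂ) n = fourierCoeff f n := fun n => by
    rw [fourierCoeff_congr_ae hf.coeFn_toLp]
  have h := hasSum_sq_fourierCoeff (hf.toLp f)
  have hint : Integrable (fun x => ‖(hf.toLp f : Torus → ℂ) x‖ ^ 2) torusMeasure :=
    (memLp_two_iff_integrable_sq_norm (Lp.aestronglyMeasurable _)).mp (Lp.memLp _)
  have e1 : ∫⁻ x, ‖f x‖ₑ ^ 2 ∂torusMeasure
      = ENNReal.ofReal (∫ x, ‖(hf.toLp f : Torus → ℂ) x‖ ^ 2 ∂torusMeasure) := by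
    rw [ofReal_integral_eq_lintegral_ofReal hint (Eventually.of_forall fun _ => by positivity)]
    refine lintegral_congr_ae ?_
    filter_upwards [hf.coeFn_toLp] with x hx
    rw [hx, ENNReal.ofReal_pow (by positivity), ofReal_norm]
  rw [e1, ← h.tsum_eq, ENNReal.ofReal_tsum_of_nonneg (fun _ => by positivity) h.summable]
  refine tsum_congr fun n => ?_
  rw [hc, ENNReal.ofReal_pow (by positivity), ofReal_norm]

lemma memLp_of_continuous {f : Torus → ℂ} (hf : Continuous f) (p : ℝ≥0∞) :
    MemLp f p torusMeasure := by
  obtain ⟨C, hC⟩ := isCompact_univ.exists_bound_of_continuousOn (f := f) hf.continuousOn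
  exact MemLp.of_bound hf.aestronglyMeasurable C (Eventually.of_forall fun x => hC x trivial)

lemma integrable_of_continuous {f : Torus → ℂ} (hf : Continuous f) : Integrable f torusMeasure :=
  memLp_one_iff_integrable.mp (memLp_of_continuous hf 1)

lemma fourierCoeff_comp_add (f : Torus → ℂ) (h : Torus) (n : ℤ) :
    fourierCoeff (fun x => f (x + h)) n = fourier n h * fourierCoeff f n := by
  have h1 : (fourier n h : ℂ) * fourier (-n) h = 1 := by
    rw [← fourier_add]; simp
  have h2 := integral_add_right_eq_self (μ := torusMeasure)
    (fun x => (fourier (-n) x : ℂ) • f x) h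
  rw [fourierCoeff, fourierCoeff, ← h2, ← integral_const_mul]
  refine integral_congr_ae (Eventually.of_forall fun x => ?_)
  simp only [smul_eq_mul, fourier_add_apply]
  linear_combination (-(fourier (-n) x : ℂ) * f (x + h)) * h1

lemma fourierCoeff_increment {f : Torus → ℂ} (hf : Continuous f) (h : Torus) (n : ℤ) :
    fourierCoeff (fun x => f (x + h) - f x) n = (fourier n h - 1) * fourierCoeff f n := by
  have h1 := fourierCoeff.add
    (integrable_of_continuous (f := fun x => f (x + h)) (by fun_prop))
    (integrable_of_continuous (f := fun x => (-1 : ℂ) * f x) (by fun_prop))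
  have h2 : (fun x => f (x + h) - f x)
      = (fun x => f (x + h)) + (fun x => (-1 : ℂ) * f x) := by
    ext x; simp [sub_eq_add_neg]
  rw [h2, h1, Pi.add_apply, fourierCoeff_comp_add, fourierCoeff.const_mul]
  ring

/-- A weighted sum of squared Fourier coefficients is controlled by the increments at dyadic
steps, since each frequency is seen by the increment at its own scale. -/
lemma tsum_weight_fourierCoeff_le {f : Torus → ℂ} (hf : Continuous f) (w : ℤ → ℝ≥0∞)
    (W : ℕ → ℝ≥0∞) (hw : ∀ n : ℤ, n ≠ 0 → w n ≤ W (Nat.log 2 n.natAbs)) :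
    ∑' n : ℤ, w n * ‖fourierCoeff f n‖ₑ ^ 2
      ≤ w 0 * ∫⁻ x, ‖f x‖ₑ ^ 2 ∂torusMeasure
        + ∑' i : ℕ, W i * ∫⁻ x, ‖f (x + dyadicStep i) - f x‖ₑ ^ 2 ∂torusMeasure := by
  have hpars : ∀ i, ∫⁻ x, ‖f (x + dyadicStep i) - f x‖ₑ ^ 2 ∂torusMeasure
      = ∑' n : ℤ, ‖(fourier n (dyadicStep i) : ℂ) - 1‖ₑ ^ 2 * ‖fourierCoeff f n‖ₑ ^ 2 := by
    intro i
    rw [← tsum_enorm_sq_fourierCoeff (memLp_of_continuous (by fun_prop) 2)]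
    refine tsum_congr fun n => ?_
    rw [fourierCoeff_increment hf, enorm_mul, mul_pow]
  rw [← tsum_enorm_sq_fourierCoeff (memLp_of_continuous hf 2)]
  simp_rw [hpars, ← ENNReal.tsum_mul_left]
  rw [ENNReal.tsum_comm, ← ENNReal.tsum_add]
  refine ENNReal.tsum_le_tsum fun n => ?_
  by_cases hn : n = 0
  · subst hn
    exact le_self_add
  · refine le_trans ?_ le_add_self
    refine le_trans ?_ (ENNReal.le_tsum (Nat.log 2 n.natAbs))
    have h1 : 1 ≤ ‖(fourier n (dyadicStep (Nat.log 2 n.natAbs)) : ℂ) - 1‖ₑ ^ 2 := by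
      rw [← ofReal_norm, ← ENNReal.ofReal_pow (by positivity)]
      exact ENNReal.one_le_ofReal.mpr (one_le_norm_sq_fourier_dyadicStep_sub_one hn)
    calc w n * ‖fourierCoeff f n‖ₑ ^ 2
        ≤ W (Nat.log 2 n.natAbs) * (1 * ‖fourierCoeff f n‖ₑ ^ 2) := by
          rw [one_mul]; gcongr; exact hw n hn
      _ ≤ _ := by gcongr

/-- The random function `f` is bounded in `L^r` and `1/2`-Hölder continuous in `L^r` at the
dyadic steps, with constant `A`. -/
def HolderBound (r : ℕ) (f : L2Torus → Torus → ℂ) (A : ℝ≥0∞) : Prop :=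
  (∀ x, MomentLE wienerMeasure r (fun u => ‖f u x‖ₑ) A) ∧
  ∀ i x, MomentLE wienerMeasure r (fun u => ‖f u (x + dyadicStep i) - f u x‖ₑ)
    (A * ENNReal.ofReal (sqrtScale i))

/-- Moments of a weighted sum of squared Fourier coefficients of a random function which is
`1/2`-Hölder in `L^{2m}`: the increment at the `i`-th dyadic step contributes `2^{-i}`. -/
lemma momentLE_weight_fourierCoeff {m : ℕ} (hm : m ≠ 0) {f : L2Torus → Torus → ℂ}
    (hf : ∀ u, Continuous (f u)) (mf : Measurable (Function.uncurry f)) {A : ℝ≥0∞}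
    (hA : HolderBound (2 * m) f A) (w : ℤ → ℝ≥0∞)
    (W : ℕ → ℝ≥0∞) (hw : ∀ n : ℤ, n ≠ 0 → w n ≤ W (Nat.log 2 n.natAbs)) :
    MomentLE wienerMeasure m (fun u => ∑' n : ℤ, w n * ‖fourierCoeff (f u) n‖ₑ ^ 2)
      (A ^ 2 * (w 0 + ∑' i : ℕ, W i * ENNReal.ofReal ((1 / 2) ^ i))) := by
  have m1 : Measurable (Function.uncurry fun u x => ‖f u x‖ₑ ^ 2) := mf.enorm.pow_const 2
  have m2 : ∀ i, Measurable
      (Function.uncurry fun u x => ‖f u (x + dyadicStep i) - f u x‖ₑ ^ 2) := fun i => by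
    have : Measurable fun p : L2Torus × Torus => f p.1 (p.2 + dyadicStep i) :=
      mf.comp (measurable_fst.prodMk (measurable_snd.add_const _))
    exact (this.sub mf).enorm.pow_const 2
  have h1 : MomentLE wienerMeasure m (fun u => ∫⁻ x, ‖f u x‖ₑ ^ 2 ∂torusMeasure) (A ^ 2) :=
    MomentLE.average hm m1 fun x => (hA.1 x).pow
  have h2 : ∀ i, MomentLE wienerMeasure m
      (fun u => ∫⁻ x, ‖f u (x + dyadicStep i) - f u x‖ₑ ^ 2 ∂torusMeasure)
      (A ^ 2 * ENNReal.ofReal ((1 / 2) ^ i)) := fun i => by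
    have := MomentLE.average (ν := torusMeasure) hm (m2 i) fun x => (hA.2 i x).pow
    rwa [mul_pow, ← ENNReal.ofReal_pow (sqrtScale_pos i).le, sqrtScale_sq] at this
  have n1 : Measurable fun u => ∫⁻ x, ‖f u x‖ₑ ^ 2 ∂torusMeasure := m1.lintegral_prod_right
  have n2 : ∀ i, Measurable fun u =>
      ∫⁻ x, ‖f u (x + dyadicStep i) - f u x‖ₑ ^ 2 ∂torusMeasure :=
    fun i => (m2 i).lintegral_prod_right
  have h3 := (h1.const_mul n1.aemeasurable (w 0)).add hm
    (MomentLE.tsum hm (fun i => (h2 i).const_mul (n2 i).aemeasurable (W i))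
      (fun i => ((n2 i).const_mul _).aemeasurable))
    (n1.const_mul _).aemeasurable
    (Measurable.tsum fun i => (n2 i).const_mul _).aemeasurable
  refine h3.mono (fun u => tsum_weight_fourierCoeff_le (hf u) w W hw) (le_of_eq ?_)
  rw [mul_add, ← ENNReal.tsum_mul_left]
  congr 1
  · ring
  · refine tsum_congr fun i => ?_
    ring

end Blocks

/-! ### Monomials in the partial sums -/

section Monomials

lemma norm_pow_sub_pow_le {a a' : ℂ} {t l : ℝ} (ha : ‖a‖ ≤ t) (ha' : ‖a'‖ ≤ t)
    (h : ‖a - a'‖ ≤ l * t) (d : ℕ) : ‖a ^ d - a' ^ d‖ ≤ d * l * t ^ d := by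
  have t0 : 0 ≤ t := (norm_nonneg _).trans ha
  have lt0 : 0 ≤ l * t := (norm_nonneg _).trans h
  induction d with
  | zero => simp
  | succ d ih =>
    have e : a ^ (d + 1) - a' ^ (d + 1) = a * (a ^ d - a' ^ d) + (a - a') * a' ^ d := by ring
    rw [e]
    calc _ ≤ ‖a‖ * ‖a ^ d - a' ^ d‖ + ‖a - a'‖ * ‖a'‖ ^ d := by
          refine (norm_add_le _ _).trans ?_
          rw [norm_mul, norm_mul, norm_pow]
      _ ≤ t * (d * l * t ^ d) + l * t * t ^ d := by gcongr
      _ = _ := by push_cast; ring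

lemma norm_monomial_sub_le {a a' b b' : ℂ} {t l : ℝ} (hl : 0 ≤ l) (ha : ‖a‖ ≤ t) (ha' : ‖a'‖ ≤ t)
    (h : ‖a - a'‖ ≤ l * t) (hb : ‖b‖ ≤ t) (hb' : ‖b'‖ ≤ t) (h' : ‖b - b'‖ ≤ l * t) (d e : ℕ) :
    ‖a ^ d * b ^ e - a' ^ d * b' ^ e‖ ≤ (d + e : ℕ) * l * t ^ (d + e) := by
  have t0 : 0 ≤ t := (norm_nonneg _).trans ha
  have h1 := norm_pow_sub_pow_le ha ha' h d
  have h2 := norm_pow_sub_pow_le hb hb' h' e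
  have e : a ^ d * b ^ e - a' ^ d * b' ^ e
    = a ^ d * (b ^ e - b' ^ e) + (a ^ d - a' ^ d) * b' ^ e := by ring
  rw [e]
  calc _ ≤ ‖a‖ ^ d * ‖b ^ _ - b' ^ _‖ + ‖a ^ d - a' ^ d‖ * ‖b'‖ ^ _ := by
        refine (norm_add_le _ _).trans ?_
        rw [norm_mul, norm_mul, norm_pow, norm_pow]
    _ ≤ t ^ d * (_ * l * t ^ _) + (d * l * t ^ d) * t ^ _ := by gcongr
    _ = _ := by push_cast; ring

/-- The size of the moments of order `2m` of monomials of degree `d` in the partial sums. -/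
def monomialSize (d m : ℕ) : ℝ := d * (6 * gaussSize (d * m)) ^ d

lemma gaussSize_nonneg (q : ℕ) : 0 ≤ gaussSize q := by unfold gaussSize; positivity

/-- Monomials of degree `D` in the partial sums: if `T` dominates the factors and their increments
divided by `√(2^{-i})`, then the monomial and its rescaled increment are at most `D T^D`. -/
lemma holderBound_monomial (M N : ℕ) (d e : ℕ) (hde : 1 ≤ d + e) {m : ℕ} (hm : 1 ≤ m) :
    HolderBound (2 * m) (fun u x => partialSum M u x ^ d * partialSum N u x ^ e)
      (ENNReal.ofReal (monomialSize (d + e) m)) := by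
  set D := d + e with hD
  have hq : 1 ≤ D * m := Nat.mul_pos hde hm
  have hr : 2 * (D * m) ≠ 0 := by omega
  -- a common majorant for the two partial sums and their rescaled increments
  set T : ℕ → Torus → L2Torus → ℝ≥0∞ := fun i x u =>
    ((‖partialSum M u x‖ₑ + ‖partialSum M u (x + dyadicStep i)‖ₑ) +
      (‖partialSum N u x‖ₑ + ‖partialSum N u (x + dyadicStep i)‖ₑ)) +
    (ENNReal.ofReal (sqrtScale i)⁻¹ * ‖partialSum M u (x + dyadicStep i) - partialSum M u x‖ₑ +
      ENNReal.ofReal (sqrtScale i)⁻¹ * ‖partialSum N u (x + dyadicStep i) - partialSum N u x‖ₑ)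
    with hT
  have mU : ∀ N x, AEMeasurable (fun u => ‖partialSum N u x‖ₑ) wienerMeasure :=
    fun N x => (measurable_partialSum_left N x).enorm.aemeasurable
  have mV : ∀ N i x, AEMeasurable
      (fun u => ‖partialSum N u (x + dyadicStep i) - partialSum N u x‖ₑ) wienerMeasure :=
    fun N i x => ((measurable_partialSum_left N _).sub
      (measurable_partialSum_left N x)).enorm.aemeasurable
  have hV : ∀ N i x, MomentLE wienerMeasure (2 * (D * m)) (fun u => ENNReal.ofReal (sqrtScale i)⁻¹ *
      ‖partialSum N u (x + dyadicStep i) - partialSum N u x‖ₑ)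
      (ENNReal.ofReal (gaussSize (D * m))) := fun N i x => by
    refine ((momentLE_partialSum_increment hq N i x).const_mul (mV N i x) _).mono
      (fun _ => le_rfl) (le_of_eq ?_)
    have := sqrtScale_pos i
    rw [← ENNReal.ofReal_mul (by positivity)]
    congr 1
    field_simp
  have hTm : ∀ i x, MomentLE wienerMeasure (2 * m) (fun u => T i x u ^ D)
      (ENNReal.ofReal ((6 * gaussSize (D * m)) ^ D)) := by
    intro i x
    have hU := fun N x => momentLE_partialSum hq N x
    have h1 : MomentLE wienerMeasure (2 * (D * m)) (T i x) _ :=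
      ((((hU M x).add hr (hU M _) (mU _ _) (mU _ _)).add hr
        ((hU N x).add hr (hU N _) (mU _ _) (mU _ _)) ((mU _ _).add (mU _ _))
        ((mU _ _).add (mU _ _)))).add hr
        ((hV M i x).add hr (hV N i x) ((mV _ _ _).const_mul _) ((mV _ _ _).const_mul _))
        (((mU _ _).add (mU _ _)).add ((mU _ _).add (mU _ _)))
        (((mV _ _ _).const_mul _).add ((mV _ _ _).const_mul _))
    have e : 2 * (D * m) = D * (2 * m) := by ring
    rw [e] at h1
    refine h1.pow.mono (fun _ => le_rfl) (le_of_eq ?_)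
    have g0 := gaussSize_nonneg (D * m)
    rw [ENNReal.ofReal_pow (by positivity)]
    congr 1
    rw [← ENNReal.ofReal_add (by positivity) (by positivity),
      ← ENNReal.ofReal_add (by positivity) (by positivity),
      ← ENNReal.ofReal_add (by positivity) (by positivity)]
    congr 1; ring
  have mT : ∀ i x, AEMeasurable (fun u => T i x u ^ D) wienerMeasure := fun i x =>
    (((((mU _ _).add (mU _ _)).add ((mU _ _).add (mU _ _)))).add
      (((mV _ _ _).const_mul _).add ((mV _ _ _).const_mul _))).pow_const D
  -- the same majorant as a real number
  have hTr : ∀ i x u, T i x u = ENNReal.ofReal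
      (((‖partialSum M u x‖ + ‖partialSum M u (x + dyadicStep i)‖) +
      (‖partialSum N u x‖ + ‖partialSum N u (x + dyadicStep i)‖)) +
    ((sqrtScale i)⁻¹ * ‖partialSum M u (x + dyadicStep i) - partialSum M u x‖ +
      (sqrtScale i)⁻¹ * ‖partialSum N u (x + dyadicStep i) - partialSum N u x‖)) := by
    intro i x u
    have := sqrtScale_pos i
    simp only [hT, ← ofReal_norm]
    rw [← ENNReal.ofReal_mul (by positivity), ← ENNReal.ofReal_mul (by positivity),
      ← ENNReal.ofReal_add (by positivity) (by positivity),
      ← ENNReal.ofReal_add (by positivity) (by positivity),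
      ← ENNReal.ofReal_add (by positivity) (by positivity),
      ← ENNReal.ofReal_add (by positivity) (by positivity),
      ← ENNReal.ofReal_add (by positivity) (by positivity)]
  have hD1 : (1 : ℝ) ≤ D := by exact_mod_cast hde
  have hsz : monomialSize D m = D * (6 * gaussSize (D * m)) ^ D := rfl
  constructor
  · intro x
    refine (hTm 0 x).mono (fun u => ?_) (ENNReal.ofReal_le_ofReal ?_)
    · rw [enorm_mul, enorm_pow, enorm_pow, hD, pow_add]
      have h1 : ‖partialSum M u x‖ₑ ≤ T 0 x u := by
        simp only [hT]; rw [add_assoc, add_assoc]; exact le_self_add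
      have h2 : ‖partialSum N u x‖ₑ ≤ T 0 x u := by
        simp only [hT]
        exact le_self_add.trans (le_add_self.trans le_self_add)
      gcongr
    · rw [hsz]
      have : 0 ≤ (6 * gaussSize (D * m)) ^ D := by have := gaussSize_nonneg (D * m); positivity
      nlinarith
  · intro i x
    have hl := sqrtScale_pos i
    refine ((hTm i x).const_mul (mT i x) (ENNReal.ofReal (D * sqrtScale i))).mono
      (fun u => ?_) (le_of_eq ?_)
    · rw [hTr, ← ENNReal.ofReal_pow (by positivity), ← ENNReal.ofReal_mul (by positivity),
        ← ofReal_norm]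
      refine ENNReal.ofReal_le_ofReal ?_
      set a := ‖partialSum M u x‖ with ha
      set a' := ‖partialSum M u (x + dyadicStep i)‖ with ha'
      set b := ‖partialSum N u x‖ with hb
      set b' := ‖partialSum N u (x + dyadicStep i)‖ with hb'
      set va := ‖partialSum M u (x + dyadicStep i) - partialSum M u x‖ with hva
      set vb := ‖partialSum N u (x + dyadicStep i) - partialSum N u x‖ with hvb
      have p1 : 0 ≤ a := norm_nonneg _
      have p2 : 0 ≤ a' := norm_nonneg _
      have p3 : 0 ≤ b := norm_nonneg _
      have p4 : 0 ≤ b' := norm_nonneg _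
      have p5 : 0 ≤ (sqrtScale i)⁻¹ * va := by positivity
      have p6 : 0 ≤ (sqrtScale i)⁻¹ * vb := by positivity
      refine norm_monomial_sub_le hl.le ?_ ?_ ?_ ?_ ?_ ?_ d e
      · linarith
      · linarith
      · calc va = sqrtScale i * ((sqrtScale i)⁻¹ * va) := by field_simp
          _ ≤ _ := by gcongr; linarith
      · linarith
      · linarith
      · calc vb = sqrtScale i * ((sqrtScale i)⁻¹ * vb) := by field_simp
          _ ≤ _ := by gcongr; linarith
    · have := gaussSize_nonneg (D * m)
      rw [← ENNReal.ofReal_mul (by positivity), ← ENNReal.ofReal_mul (by rw [hsz]; positivity), hsz]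
      congr 1; ring

lemma HolderBound.sum {r : ℕ} (hr : r ≠ 0) {ι : Type*} (S : Finset ι)
    {f : ι → L2Torus → Torus → ℂ} {A : ℝ≥0∞}
    (hf : ∀ i ∈ S, HolderBound r (f i) A) (mf : ∀ i x, Measurable fun u => f i u x) :
    HolderBound r (fun u x => ∑ i ∈ S, f i u x) (S.card * A) := by
  constructor
  · intro x
    refine (MomentLE.sum hr S (fun i hi => (hf i hi).1 x)
      (fun i _ => (mf i x).enorm.aemeasurable)).mono (fun u => enorm_sum_le _ _) (by simp)
  · intro j x
    refine (MomentLE.sum hr S (fun i hi => (hf i hi).2 j x)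
      (fun i _ => ((mf i _).sub (mf i x)).enorm.aemeasurable)).mono (fun u => ?_)
      (by simp [mul_assoc])
    rw [← Finset.sum_sub_distrib]
    exact enorm_sum_le _ _

/-- The quotient `((P_M u)^k - (P_N u)^k) / (P_M u - P_N u)`. -/
def powQuotient (k M N : ℕ) (u : L2Torus) (x : Torus) : ℂ :=
  ∑ i ∈ Finset.range k, partialSum M u x ^ i * partialSum N u x ^ (k - 1 - i)

lemma measurable_powQuotient (k M N : ℕ) : Measurable (Function.uncurry (powQuotient k M N)) := by
  unfold powQuotient Function.uncurry
  refine Finset.measurable_fun_sum _ fun i _ => ?_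
  exact ((measurable_partialSum M).pow_const i).mul ((measurable_partialSum N).pow_const _)

lemma continuous_powQuotient (k M N : ℕ) (u : L2Torus) : Continuous (powQuotient k M N u) := by
  refine continuous_finsetSum _ fun i _ => ?_
  exact ((continuous_partialSum M u).pow i).mul ((continuous_partialSum N u).pow _)

lemma powQuotient_mul (k M N : ℕ) (u : L2Torus) (x : Torus) :
    powQuotient k M N u x * (partialSum M u x - partialSum N u x)
      = partialSum M u x ^ k - partialSum N u x ^ k :=
  geom_sum₂_mul _ _ k

lemma holderBound_powQuotient {k : ℕ} (hk : 2 ≤ k) (M N : ℕ) {m : ℕ} (hm : 1 ≤ m) :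
    HolderBound (2 * m) (powQuotient k M N) (k * ENNReal.ofReal (monomialSize (k - 1) m)) := by
  have h := HolderBound.sum (r := 2 * m) (by omega) (Finset.range k)
    (f := fun i u x => partialSum M u x ^ i * partialSum N u x ^ (k - 1 - i))
    (A := ENNReal.ofReal (monomialSize (k - 1) m)) (fun i hi => by
      have hi := Finset.mem_range.mp hi
      have e : i + (k - 1 - i) = k - 1 := by omega
      have := holderBound_monomial M N i (k - 1 - i) (by omega) hm
      rwa [e] at this)
    (fun i x => ((measurable_partialSum_left M x).pow_const _).mul
      ((measurable_partialSum_left N x).pow_const _))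
  rw [Finset.card_range] at h
  exact h

lemma holderBound_pow {k : ℕ} (hk : 2 ≤ k) (N : ℕ) {m : ℕ} (hm : 1 ≤ m) :
    HolderBound (2 * m) (fun u x => partialSum N u x ^ k)
      (ENNReal.ofReal (monomialSize k m)) := by
  simpa using holderBound_monomial N N k 0 (by omega) hm

end Monomials

/-! ### Moments of the truncated powers -/

section Truncated

/-- The Sobolev weight `(1 + n²)^s`. -/
def sobolevWeight (s : ℝ) (n : ℤ) : ℝ≥0∞ := ENNReal.ofReal ((1 + (n : ℝ) ^ 2) ^ s)

lemma tsum_geometric_tail_le (n : ℕ) :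
    ∑' i : ℕ, (if n ≤ i then ENNReal.ofReal ((1 / 2) ^ i) else 0)
      ≤ ENNReal.ofReal (2 * (1 / 2) ^ n) := by
  induction n with
  | zero =>
    simp only [zero_le, if_true, pow_zero, mul_one]
    rw [← ENNReal.ofReal_tsum_of_nonneg (fun _ => by positivity) summable_geometric_two,
      tsum_geometric_two]
  | succ n ih =>
    rw [tsum_eq_zero_add' ENNReal.summable]
    have : ∀ i : ℕ, (if n + 1 ≤ i + 1 then ENNReal.ofReal ((1 / 2) ^ (i + 1)) else 0)
        = ENNReal.ofReal (1 / 2) * (if n ≤ i then ENNReal.ofReal ((1 / 2) ^ i) else 0) := by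
      intro i
      simp only [add_le_add_iff_right]
      split_ifs
      · rw [← ENNReal.ofReal_mul (by norm_num), pow_succ, mul_comm]
      · simp
    simp_rw [this]
    rw [ENNReal.tsum_mul_left]
    simp only [Nat.le_zero_eq, Nat.add_eq_zero_iff, one_ne_zero, and_false, if_false, zero_add]
    refine (mul_le_mul_right ih _).trans (le_of_eq ?_)
    rw [← ENNReal.ofReal_mul (by norm_num)]
    congr 1; ring

/-- The dyadic scales that see a frequency above `N / 2` have total weight `O(1 / N)`. -/
lemma tsum_high_scales_le {N : ℕ} (hN : 1 ≤ N) :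
    ∑' i : ℕ, (if N < 2 ^ (i + 2) then (1 : ℝ≥0∞) else 0) * ENNReal.ofReal ((1 / 2) ^ i)
      ≤ ENNReal.ofReal (8 / N) := by
  set L := Nat.log 2 N with hL
  have hN' : (0 : ℝ) < N := by exact_mod_cast hN
  have l1 : 2 ^ L ≤ N := Nat.pow_log_le_self 2 (by omega)
  have l2 : N < 2 ^ (L + 1) := Nat.lt_pow_succ_log_self (by norm_num) _
  refine (ENNReal.tsum_le_tsum fun i => ?_).trans ((tsum_geometric_tail_le (L - 1)).trans
    (ENNReal.ofReal_le_ofReal ?_))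
  · split_ifs with h1 h2
    · simp
    · exfalso
      have : 2 ^ L < 2 ^ (i + 2) := l1.trans_lt h1
      have := (Nat.pow_lt_pow_iff_right (by norm_num : 1 < 2)).mp this
      omega
    · simp
    · simp
  · have l2' : (N : ℝ) ≤ 2 ^ (L + 1) := by exact_mod_cast l2.le
    have e : (1 / 2 : ℝ) ^ (L - 1) * 2 ^ (L + 1) ≤ 4 := by
      rcases Nat.eq_zero_or_pos L with h | h
      · rw [h]; norm_num
      · obtain ⟨j, hj⟩ : ∃ j, L = j + 1 := ⟨L - 1, by omega⟩
        rw [hj, Nat.add_sub_cancel, pow_add, pow_add, ← mul_assoc, ← mul_assoc, ← mul_pow]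
        norm_num
    rw [le_div_iff₀ hN']
    have p : (0 : ℝ) < (1 / 2) ^ (L - 1) := by positivity
    nlinarith

/-- The Sobolev weight of order `s < 1/2` is summable over the dyadic blocks against the mass
`2^{-i}` of a `1/2`-Hölder function. -/
lemma exists_tsum_dyadic_sobolevWeight_le {s : ℝ} (hs : s < 1 / 2) :
    ∃ (B : ℝ) (W : ℕ → ℝ≥0∞), 0 < B ∧
      (∀ n : ℤ, n ≠ 0 → sobolevWeight s n ≤ W (Nat.log 2 n.natAbs)) ∧
      sobolevWeight s 0 + ∑' i : ℕ, W i * ENNReal.ofReal ((1 / 2) ^ i) ≤ ENNReal.ofReal B := by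
  set t := max s 0 with ht
  have t0 : 0 ≤ t := le_max_right _ _
  have t1 : t < 1 / 2 := max_lt hs (by norm_num)
  set ρ : ℝ := 4 ^ t / 2 with hρ
  have ρ0 : 0 ≤ ρ := by positivity
  have ρ1 : ρ < 1 := by
    have : (4 : ℝ) ^ t < 4 ^ (1 / 2 : ℝ) := Real.rpow_lt_rpow_of_exponent_lt (by norm_num) t1
    have e : (4 : ℝ) ^ (1 / 2 : ℝ) = 2 := by
      rw [show (4 : ℝ) = 2 ^ (2 : ℝ) by norm_num, ← Real.rpow_mul (by norm_num)]; norm_num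
    rw [hρ, div_lt_one (by norm_num)]; linarith
  refine ⟨1 + 8 ^ t * (1 - ρ)⁻¹, fun i => ENNReal.ofReal ((8 * 4 ^ i) ^ t), ?_, ?_, ?_⟩
  · have : 0 < 1 - ρ := by linarith
    positivity
  · intro n hn
    refine ENNReal.ofReal_le_ofReal ?_
    set i := Nat.log 2 n.natAbs
    have l2 : n.natAbs < 2 ^ (i + 1) := Nat.lt_pow_succ_log_self (by norm_num) _
    have l2' : |(n : ℝ)| ≤ 2 ^ (i + 1) := by
      rw [← natCast_natAbs_real]; exact_mod_cast l2.le
    have l3 : (n : ℝ) ^ 2 ≤ 4 * 4 ^ i := by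
      rw [← sq_abs]
      calc |(n : ℝ)| ^ 2 ≤ (2 ^ (i + 1)) ^ 2 := by gcongr
        _ = 4 * 4 ^ i := by rw [← pow_mul, mul_comm, pow_mul, pow_succ]; norm_num; ring
    have l4 : (1 : ℝ) ≤ 4 ^ i := one_le_pow₀ (by norm_num)
    calc (1 + (n : ℝ) ^ 2) ^ s ≤ (1 + (n : ℝ) ^ 2) ^ t :=
          Real.rpow_le_rpow_of_exponent_le (by nlinarith [sq_nonneg (n : ℝ)]) (le_max_left _ _)
      _ ≤ (8 * 4 ^ i) ^ t := by
          refine Real.rpow_le_rpow (by positivity) ?_ t0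
          linarith
  · have hterm : ∀ i : ℕ, ENNReal.ofReal ((8 * 4 ^ i) ^ t) * ENNReal.ofReal ((1 / 2) ^ i)
        = ENNReal.ofReal (8 ^ t * ρ ^ i) := by
      intro i
      rw [← ENNReal.ofReal_mul (by positivity)]
      congr 1
      have e : ((4 : ℝ) ^ i) ^ t = ((4 : ℝ) ^ t) ^ i := by
        rw [← Real.rpow_natCast, ← Real.rpow_natCast, ← Real.rpow_mul (by norm_num),
          ← Real.rpow_mul (by norm_num), mul_comm]
      rw [Real.mul_rpow (by norm_num) (by positivity), e, hρ, div_pow, div_pow, one_pow]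
      ring
    simp_rw [hterm]
    rw [← ENNReal.ofReal_tsum_of_nonneg (fun _ => by positivity)
      ((summable_geometric_of_lt_one ρ0 ρ1).mul_left _), tsum_mul_left,
      tsum_geometric_of_lt_one ρ0 ρ1, ENNReal.ofReal_add (by norm_num)
        (mul_nonneg (by positivity) (inv_nonneg.mpr (by linarith)))]
    gcongr
    simp [sobolevWeight]

lemma exists_tsum_sobolevWeight_le {s : ℝ} (hs : s < -(1 / 2)) :
    ∃ Z : ℝ, 0 < Z ∧ ∑' n : ℤ, sobolevWeight s n ≤ ENNReal.ofReal Z := by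
  have hsum : Summable fun n : ℤ => (1 + (n : ℝ) ^ 2) ^ s := by
    have h1 : Summable fun n : ℤ => |(n : ℝ)| ^ (2 * s) := by
      have := Real.summable_abs_int_rpow (b := -(2 * s)) (by linarith)
      simpa using this
    refine Summable.of_norm_bounded_eventually h1 ?_
    rw [Filter.eventually_cofinite]
    refine (Set.finite_singleton (0 : ℤ)).subset fun n hn => ?_
    by_contra h0
    refine hn ?_
    have hn0 : (n : ℝ) ≠ 0 := by exact_mod_cast h0
    have hp : 0 < |(n : ℝ)| := abs_pos.mpr hn0
    rw [Real.norm_of_nonneg (by positivity), Real.rpow_mul hp.le]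
    refine Real.rpow_le_rpow_of_nonpos (by positivity) ?_ (by linarith)
    rw [Real.rpow_two, sq_abs]; linarith
  refine ⟨∑' n : ℤ, (1 + (n : ℝ) ^ 2) ^ s, ?_, ?_⟩
  · exact hsum.tsum_pos (fun _ => by positivity) 0 (by positivity)
  · rw [ENNReal.ofReal_tsum_of_nonneg (fun _ => by positivity) hsum]
    rfl

/-- The constant in the square of `monomialSize`. -/
def monomialConst (d : ℕ) : ℝ := d ^ 2 * 384 ^ (2 * d) * (2 * d) ^ d

lemma monomialConst_pos {d : ℕ} (hd : 1 ≤ d) : 0 < monomialConst d := by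
  have : (0 : ℝ) < d := by exact_mod_cast hd
  unfold monomialConst; positivity

lemma monomialSize_sq (d m : ℕ) : monomialSize d m ^ 2 = monomialConst d * (m : ℝ) ^ d := by
  have h : √((2 * (d * m) : ℕ) : ℝ) ^ 2 = 2 * d * m := by
    rw [Real.sq_sqrt (by positivity)]; push_cast; ring
  unfold monomialSize gaussSize monomialConst
  set y := √((2 * (d * m) : ℕ) : ℝ)
  calc ((d : ℝ) * (6 * (64 * y)) ^ d) ^ 2 = d ^ 2 * 384 ^ (2 * d) * (y ^ 2) ^ d := by
        rw [show 6 * (64 * y) = 384 * y by ring, mul_pow, mul_pow, mul_pow]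
        ring
    _ = _ := by rw [h, mul_pow]; ring

lemma monomialSize_nonneg (d m : ℕ) : 0 ≤ monomialSize d m := by
  have := gaussSize_nonneg (d * m)
  unfold monomialSize; positivity

/-- The Fourier coefficients of `(P_N u)^k`. -/
def powCoeff (k N : ℕ) (u : L2Torus) (n : ℤ) : ℂ :=
  fourierCoeff (fun x => partialSum N u x ^ k) n

lemma measurable_powCoeff (k N : ℕ) (n : ℤ) : Measurable fun u => powCoeff k N u n := by
  have h : StronglyMeasurable (Function.uncurry fun (u : L2Torus) (x : Torus) =>
      (fourier (-n) x : ℂ) • partialSum N u x ^ k) := by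
    refine Measurable.stronglyMeasurable ?_
    exact ((fourier (-n)).continuous.measurable.comp measurable_snd).mul
      ((measurable_partialSum N).pow_const k)
  exact (h.integral_prod_right (ν := torusMeasure)).measurable

/-- Moments of the squared `H^s` norm of `(P_N u)^k`, uniformly in `N`. -/
lemma exists_momentLE_powCoeff {k : ℕ} (hk : 2 ≤ k) {s : ℝ} (hs : s < 1 / 2) :
    ∃ B : ℝ, 0 < B ∧ ∀ m : ℕ, 1 ≤ m → ∀ N : ℕ, MomentLE wienerMeasure m
      (fun u => ∑' n : ℤ, sobolevWeight s n * ‖powCoeff k N u n‖ₑ ^ 2)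
      (ENNReal.ofReal (B * (m : ℝ) ^ k)) := by
  obtain ⟨B, W, hB, hW, hsum⟩ := exists_tsum_dyadic_sobolevWeight_le hs
  refine ⟨B * monomialConst k, mul_pos hB (monomialConst_pos (by omega)), fun m hm N => ?_⟩
  have h := momentLE_weight_fourierCoeff (m := m) (by omega)
    (fun u => (continuous_partialSum N u).pow k) ((measurable_partialSum N).pow_const k)
    (holderBound_pow hk N hm) (sobolevWeight s) W hW
  refine h.mono (fun u => le_rfl) ?_
  rw [← ENNReal.ofReal_pow (monomialSize_nonneg _ _), monomialSize_sq]
  refine (mul_le_mul_right hsum _).trans (le_of_eq ?_)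
  rw [← ENNReal.ofReal_mul (mul_nonneg (monomialConst_pos (by omega)).le (by positivity))]
  congr 1; ring

end Truncated

/-! ### Differences of truncated powers -/

section Differences

lemma fourierCoeff_fourier_mul (f : Torus → ℂ) (j n : ℤ) :
    fourierCoeff (fun x => fourier j x * f x) n = fourierCoeff f (n - j) := by
  rw [fourierCoeff, fourierCoeff]
  refine integral_congr_ae (Eventually.of_forall fun x => ?_)
  simp only [smul_eq_mul]
  rw [show -(n - j) = -n + j by ring, fourier_add]
  ring

/-- The frequencies `N < |j| ≤ M`. -/
def shell (N M : ℕ) : Finset ℤ := Finset.Icc (-(M : ℤ)) M \ Finset.Icc (-(N : ℤ)) N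

lemma powCoeff_sub {k N M : ℕ} (h : N ≤ M) (u : L2Torus) (n : ℤ) :
    powCoeff k M u n - powCoeff k N u n
      = ∑ j ∈ shell N M, fourierCoeff (u : Torus → ℂ) j
          * fourierCoeff (powQuotient k M N u) (n - j) := by
  have hc := continuous_powQuotient k M N u
  have hU : Continuous fun x => partialSum N u x ^ k := (continuous_partialSum N u).pow k
  have h1 : (fun x => partialSum M u x ^ k) = (fun x => partialSum N u x ^ k)
      + ∑ j ∈ shell N M, fun x => fourierCoeff (u : Torus → ℂ) j *
        (fourier j x * powQuotient k M N u x) := by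
    ext x
    have := powQuotient_mul k M N u x
    rw [partialSum_sub h, Finset.mul_sum] at this
    rw [Pi.add_apply, Finset.sum_apply]
    rw [← sub_eq_iff_eq_add', ← this]
    refine Finset.sum_congr rfl fun j _ => ?_
    ring
  have hi : ∀ j, Integrable (fun x => fourierCoeff (u : Torus → ℂ) j *
        (fourier j x * powQuotient k M N u x)) torusMeasure := fun j =>
    integrable_of_continuous (((fourier j).continuous.mul hc).const_mul _)
  rw [powCoeff, powCoeff, h1, fourierCoeff.add (integrable_of_continuous hU)
    (integrable_finsetSum' _ fun j _ => hi j), Pi.add_apply, add_sub_cancel_left,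
    fourierCoeff.sum _ _ (fun j _ => hi j), Finset.sum_apply]
  refine Finset.sum_congr rfl fun j _ => ?_
  rw [fourierCoeff.const_mul, fourierCoeff_fourier_mul]

lemma enorm_sq_sum_mul_le {ι : Type*} (S : Finset ι) (a b : ι → ℂ) :
    ‖∑ i ∈ S, a i * b i‖ₑ ^ 2 ≤ (∑ i ∈ S, ‖a i‖ₑ ^ 2) * ∑ i ∈ S, ‖b i‖ₑ ^ 2 := by
  have h1 : ‖∑ i ∈ S, a i * b i‖ ≤ ∑ i ∈ S, ‖a i‖ * ‖b i‖ := by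
    simpa using norm_sum_le S fun i => a i * b i
  have h2 := Finset.sum_mul_sq_le_sq_mul_sq S (fun i => ‖a i‖) (fun i => ‖b i‖)
  simp only [← ofReal_norm, ← ENNReal.ofReal_pow (norm_nonneg _)]
  rw [← ENNReal.ofReal_sum_of_nonneg (fun _ _ => by positivity),
    ← ENNReal.ofReal_sum_of_nonneg (fun _ _ => by positivity), ← ENNReal.ofReal_mul
      (Finset.sum_nonneg fun _ _ => by positivity)]
  refine ENNReal.ofReal_le_ofReal (le_trans ?_ h2)
  gcongr

/-- The mass of the frequencies above `N / 2` of the quotient of powers. -/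
def quotientTail (k M N : ℕ) (u : L2Torus) : ℝ≥0∞ :=
  ∑' l : ℤ, (if N < 2 * l.natAbs then 1 else 0) * ‖fourierCoeff (powQuotient k M N u) l‖ₑ ^ 2

/-- The mass of the frequencies in `N < |j| ≤ M` of the loop. -/
def shellMass (N M : ℕ) (u : L2Torus) : ℝ≥0∞ :=
  ∑ j ∈ shell N M, ‖fourierCoeff (u : Torus → ℂ) j‖ₑ ^ 2

lemma measurable_shellMass (N M : ℕ) : Measurable (shellMass N M) := by
  unfold shellMass
  exact Finset.measurable_fun_sum _ fun j _ =>
    (continuous_fourierCoeff_L2 j).measurable.enorm.pow_const 2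

lemma measurable_quotientTail (k M N : ℕ) : Measurable (quotientTail k M N) := by
  unfold quotientTail
  refine Measurable.tsum fun l => Measurable.const_mul (Measurable.pow_const ?_ 2) _
  have h : StronglyMeasurable (Function.uncurry fun (u : L2Torus) (x : Torus) =>
      (fourier (-l) x : ℂ) • powQuotient k M N u x) := by
    refine Measurable.stronglyMeasurable ?_
    exact ((fourier (-l)).continuous.measurable.comp measurable_snd).mul
      (measurable_powQuotient k M N)
  exact (h.integral_prod_right (ν := torusMeasure)).measurable.enorm

/-- At frequencies `|n| ≤ N / 2` the difference of the powers is a convolution of two sequences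
living at frequencies above `N / 2`. -/
lemma enorm_powCoeff_sub_sq_le {k N M : ℕ} (h : N ≤ M) (u : L2Torus) {n : ℤ}
    (hn : 2 * n.natAbs ≤ N) :
    ‖powCoeff k M u n - powCoeff k N u n‖ₑ ^ 2 ≤ shellMass N M u * quotientTail k M N u := by
  rw [powCoeff_sub h]
  refine (enorm_sq_sum_mul_le _ _ _).trans ?_
  refine mul_le_mul_right ?_ _
  set w : ℤ → ℝ≥0∞ := fun l =>
    (if N < 2 * l.natAbs then 1 else 0) * ‖fourierCoeff (powQuotient k M N u) l‖ₑ ^ 2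
  calc ∑ j ∈ shell N M, ‖fourierCoeff (powQuotient k M N u) (n - j)‖ₑ ^ 2
      = ∑ j ∈ shell N M, w (n - j) := by
        refine Finset.sum_congr rfl fun j hj => ?_
        have := lt_natAbs_of_mem_sdiff hj
        have h' : N < 2 * (n - j).natAbs := by omega
        simp only [w, if_pos h', one_mul]
    _ ≤ ∑' j, w (n - j) := ENNReal.sum_le_tsum _
    _ = ∑' l, w l := (Equiv.subLeft n).tsum_eq w

lemma momentLE_shellMass {N M : ℕ} (hN : 1 ≤ N) {q : ℕ} (hq : 1 ≤ q) :
    MomentLE wienerMeasure q (shellMass N M) (ENNReal.ofReal (1024 * q / N)) := by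
  have hN' : (0 : ℝ) < N := by exact_mod_cast hN
  have h1 : ∀ j ∈ shell N M, MomentLE wienerMeasure q
      (fun u => ‖fourierCoeff (u : Torus → ℂ) j‖ₑ ^ 2)
      (ENNReal.ofReal (512 * q * (1 / (j : ℝ) ^ 2))) := by
    intro j hj
    have hj0 : (j : ℝ) ≠ 0 := by
      have := lt_natAbs_of_mem_sdiff hj
      have : j ≠ 0 := by omega
      exact_mod_cast this
    have hj1 : 0 < |(j : ℝ)| := abs_pos.mpr hj0
    have := momentLE_fourierCoeff_form (fun _ => 1) {j} (v := 1 / |(j : ℝ)|) (by positivity)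
      (by simp) hq
    simp only [Finset.sum_singleton, one_mul] at this
    refine this.pow.mono (fun _ => le_rfl) (le_of_eq ?_)
    rw [← ENNReal.ofReal_pow (by positivity), mul_pow, mul_pow, Real.sq_sqrt (by positivity),
      div_pow, sq_abs]
    congr 1
    push_cast; ring
  refine (MomentLE.sum (by omega) _ h1 fun j _ =>
    ((continuous_fourierCoeff_L2 j).measurable.enorm.pow_const 2).aemeasurable).mono
    (fun _ => le_rfl) ?_
  rw [← ENNReal.ofReal_sum_of_nonneg (fun _ _ => by positivity), ← Finset.mul_sum]
  refine ENNReal.ofReal_le_ofReal ?_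
  have := sum_tail_inv_sq_le (N := N) (by omega) (shell N M) fun j hj => lt_natAbs_of_mem_sdiff hj
  calc 512 * (q : ℝ) * ∑ j ∈ shell N M, 1 / (j : ℝ) ^ 2 ≤ 512 * q * (2 / N) := by gcongr
    _ = _ := by ring

lemma momentLE_quotientTail {k : ℕ} (hk : 2 ≤ k) {N : ℕ} (M : ℕ) (hN : 1 ≤ N) {q : ℕ}
    (hq : 1 ≤ q) : MomentLE wienerMeasure q (quotientTail k M N)
      (ENNReal.ofReal (8 * k ^ 2 * monomialConst (k - 1) * (q : ℝ) ^ (k - 1) / N)) := by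
  have h := momentLE_weight_fourierCoeff (m := q) (by omega)
    (continuous_powQuotient k M N) (measurable_powQuotient k M N)
    (holderBound_powQuotient hk M N hq) (fun l => if N < 2 * l.natAbs then 1 else 0)
    (fun i => if N < 2 ^ (i + 2) then 1 else 0) (by
      intro n _
      have l2 : n.natAbs < 2 ^ (Nat.log 2 n.natAbs + 1) :=
        Nat.lt_pow_succ_log_self (by norm_num) _
      split_ifs with h1 h2
      · exact le_rfl
      · exfalso
        rw [pow_succ] at h2
        omega
      · simp
      · simp)
  refine h.mono (fun u => le_rfl) ?_
  have hc : (0 : ℝ) ≤ monomialConst (k - 1) := (monomialConst_pos (by omega)).le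
  simp only [Int.natAbs_zero, mul_zero, not_lt_zero, if_false, zero_add]
  refine (mul_le_mul_right (tsum_high_scales_le hN) _).trans (le_of_eq ?_)
  rw [mul_pow, ← ENNReal.ofReal_pow (monomialSize_nonneg _ _), monomialSize_sq,
    ← ENNReal.ofReal_natCast, ← ENNReal.ofReal_pow (by positivity),
    ← ENNReal.ofReal_mul (by positivity), ← ENNReal.ofReal_mul (by positivity)]
  congr 1; ring

/-- The Fourier coefficients of `F_N(u) = P_N [(P_N u)^k]`. -/
def truncCoeff (k N : ℕ) (u : L2Torus) (n : ℤ) : ℂ :=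
  if n.natAbs ≤ N then powCoeff k N u n else 0

lemma measurable_truncCoeff (k N : ℕ) (n : ℤ) : Measurable fun u => truncCoeff k N u n := by
  unfold truncCoeff
  split_ifs
  · exact measurable_powCoeff k N n
  · exact measurable_const

lemma enorm_truncCoeff_le (k N : ℕ) (u : L2Torus) (n : ℤ) :
    ‖truncCoeff k N u n‖ₑ ≤ ‖powCoeff k N u n‖ₑ := by
  unfold truncCoeff
  split_ifs <;> simp

lemma enorm_sub_sq_le (a b : ℂ) : ‖a - b‖ₑ ^ 2 ≤ 2 * (‖a‖ₑ ^ 2 + ‖b‖ₑ ^ 2) := by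
  simp only [← ofReal_norm, ← ENNReal.ofReal_pow (norm_nonneg _)]
  rw [← ENNReal.ofReal_add (by positivity) (by positivity),
    show (2 : ℝ≥0∞) = ENNReal.ofReal 2 by simp, ← ENNReal.ofReal_mul (by norm_num)]
  refine ENNReal.ofReal_le_ofReal ?_
  have := norm_sub_le a b
  nlinarith [norm_nonneg (a - b), norm_nonneg a, norm_nonneg b, sq_nonneg (‖a‖ - ‖b‖)]

lemma sobolevWeight_high_le {s ε : ℝ} (hε : 0 < ε) (hε1 : ε ≤ 1) {N : ℕ} (hN : 1 ≤ N) {n : ℤ}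
    (hn : N < 2 * n.natAbs) :
    sobolevWeight s n
      ≤ ENNReal.ofReal (4 * ((N : ℝ) ^ (2 * ε))⁻¹) * sobolevWeight (s + ε) n := by
  have hN' : (0 : ℝ) < N := by exact_mod_cast hN
  unfold sobolevWeight
  rw [← ENNReal.ofReal_mul (by positivity)]
  refine ENNReal.ofReal_le_ofReal ?_
  have hp : (0 : ℝ) < 1 + (n : ℝ) ^ 2 := by positivity
  have h1 : (N : ℝ) ^ 2 / 4 ≤ 1 + (n : ℝ) ^ 2 := by
    have : (N : ℝ) ≤ 2 * |(n : ℝ)| := by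
      rw [← natCast_natAbs_real]; exact_mod_cast hn.le
    have h2 : (N : ℝ) ^ 2 ≤ (2 * |(n : ℝ)|) ^ 2 := by gcongr
    rw [mul_pow, sq_abs] at h2
    linarith
  have h3 : ((N : ℝ) ^ 2 / 4) ^ ε ≤ (1 + (n : ℝ) ^ 2) ^ ε :=
    Real.rpow_le_rpow (by positivity) h1 hε.le
  have h4 : ((N : ℝ) ^ 2 / 4) ^ ε = (N : ℝ) ^ (2 * ε) / 4 ^ ε := by
    rw [Real.div_rpow (by positivity) (by norm_num), ← Real.rpow_natCast, ← Real.rpow_mul hN'.le]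
    norm_num
  have h5 : (4 : ℝ) ^ ε ≤ 4 := by
    calc (4 : ℝ) ^ ε ≤ 4 ^ (1 : ℝ) := Real.rpow_le_rpow_of_exponent_le (by norm_num) hε1
      _ = 4 := by norm_num
  have h6 : (N : ℝ) ^ (2 * ε) ≤ 4 * (1 + (n : ℝ) ^ 2) ^ ε := by
    rw [h4, div_le_iff₀ (by positivity)] at h3
    calc _ ≤ (1 + (n : ℝ) ^ 2) ^ ε * 4 ^ ε := h3
      _ ≤ (1 + (n : ℝ) ^ 2) ^ ε * 4 := by gcongr
      _ = _ := mul_comm _ _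
  have hNp : 0 < (N : ℝ) ^ (2 * ε) := by positivity
  rw [Real.rpow_add hp]
  have h7 : 1 ≤ 4 * ((N : ℝ) ^ (2 * ε))⁻¹ * (1 + (n : ℝ) ^ 2) ^ ε := by
    rw [mul_right_comm, ← div_eq_mul_inv, one_le_div hNp]
    exact h6
  have h8 : 0 < (1 + (n : ℝ) ^ 2) ^ s := by positivity
  nlinarith

/-- At low frequencies the weight is compared with the summable weight of order `s + ε - 1`. -/
lemma sobolevWeight_low_le {s ε : ℝ} (hε : 0 < ε) (hε1 : ε ≤ 1) {N : ℕ} (hN : 1 ≤ N) {n : ℤ}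
    (hn : 2 * n.natAbs ≤ N) :
    sobolevWeight s n ≤ ENNReal.ofReal (4 * (N : ℝ) ^ 2 * ((N : ℝ) ^ (2 * ε))⁻¹)
      * sobolevWeight (s + ε - 1) n := by
  have hN' : (1 : ℝ) ≤ N := by exact_mod_cast hN
  unfold sobolevWeight
  rw [← ENNReal.ofReal_mul (by positivity)]
  refine ENNReal.ofReal_le_ofReal ?_
  have hp : (0 : ℝ) < 1 + (n : ℝ) ^ 2 := by positivity
  have h1 : 1 + (n : ℝ) ^ 2 ≤ (2 * N) ^ 2 := by
    have : 2 * |(n : ℝ)| ≤ N := by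
      rw [← natCast_natAbs_real]; exact_mod_cast hn
    rw [← sq_abs]
    nlinarith [abs_nonneg (n : ℝ)]
  have e : (1 + (n : ℝ) ^ 2) ^ s
      = (1 + (n : ℝ) ^ 2) ^ (1 - ε) * (1 + (n : ℝ) ^ 2) ^ (s + ε - 1) := by
    rw [← Real.rpow_add hp]; congr 1; ring
  rw [e]
  refine mul_le_mul_of_nonneg_right ?_ (by positivity)
  calc (1 + (n : ℝ) ^ 2) ^ (1 - ε) ≤ ((2 * (N : ℝ)) ^ 2) ^ (1 - ε) :=
        Real.rpow_le_rpow hp.le h1 (by linarith)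
    _ = (2 * (N : ℝ)) ^ 2 * ((2 * (N : ℝ)) ^ (2 * ε))⁻¹ := by
        rw [← Real.rpow_natCast, ← Real.rpow_mul (by positivity), ← Real.rpow_neg (by positivity),
          ← Real.rpow_add (by positivity)]
        congr 1; push_cast; ring
    _ ≤ (2 * (N : ℝ)) ^ 2 * ((N : ℝ) ^ (2 * ε))⁻¹ := by
        gcongr
        linarith
    _ = _ := by ring

/-- Moments of the squared `H^s` norm of `F_M(u) - F_N(u)` for finite `N ≤ M`. The frequencies above
`N / 2` are bounded through the `H^{s+ε}` norms of the two terms, the others through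
`enorm_powCoeff_sub_sq_le`. -/
lemma exists_momentLE_truncCoeff_sub {k : ℕ} (hk : 2 ≤ k) {s ε : ℝ} (hε : 0 < ε) (hε1 : ε ≤ 1)
    (hs : s + ε < 1 / 2) :
    ∃ B : ℝ, 0 < B ∧ ∀ m : ℕ, 1 ≤ m → ∀ N M : ℕ, 1 ≤ N → N ≤ M → MomentLE wienerMeasure m
      (fun u => ∑' n : ℤ, sobolevWeight s n * ‖truncCoeff k M u n - truncCoeff k N u n‖ₑ ^ 2)
      (ENNReal.ofReal (B * (m : ℝ) ^ k * ((N : ℝ) ^ (2 * ε))⁻¹)) := by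
  obtain ⟨B, hB, hpow⟩ := exists_momentLE_powCoeff hk hs
  obtain ⟨Z, hZ, hZsum⟩ := exists_tsum_sobolevWeight_le (s := s + ε - 1) (by linarith)
  set c := monomialConst (k - 1) with hc
  have hc0 : 0 < c := monomialConst_pos (by omega)
  have hk0 : (0 : ℝ) < k := by exact_mod_cast (by omega : 0 < k)
  refine ⟨16 * B + 4 * Z * (1024 * 2 * (8 * k ^ 2 * c * 2 ^ (k - 1))), by positivity,
    fun m hm N M hN hNM => ?_⟩
  have hN' : (0 : ℝ) < N := by exact_mod_cast hN
  have hm0 : m ≠ 0 := by omega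
  set δ := ((N : ℝ) ^ (2 * ε))⁻¹ with hδ
  have hδ0 : 0 < δ := by positivity
  set Φ : ℕ → L2Torus → ℝ≥0∞ := fun N u =>
    ∑' n : ℤ, sobolevWeight (s + ε) n * ‖powCoeff k N u n‖ₑ ^ 2 with hΦ
  have mΦ : ∀ N, Measurable (Φ N) := fun N =>
    Measurable.tsum fun n => ((measurable_powCoeff k N n).enorm.pow_const 2).const_mul _
  have mV := measurable_shellMass N M
  have mR := measurable_quotientTail k M N
  have hpt : ∀ u, ∑' n : ℤ, sobolevWeight s n * ‖truncCoeff k M u n - truncCoeff k N u n‖ₑ ^ 2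
      ≤ ENNReal.ofReal (8 * δ) * (Φ M u + Φ N u)
        + ENNReal.ofReal (4 * N ^ 2 * δ * Z) * (shellMass N M u * quotientTail k M N u) := by
    intro u
    set y := shellMass N M u * quotientTail k M N u
    have hterm : ∀ n : ℤ, sobolevWeight s n * ‖truncCoeff k M u n - truncCoeff k N u n‖ₑ ^ 2
        ≤ ENNReal.ofReal (8 * δ) * (sobolevWeight (s + ε) n * ‖powCoeff k M u n‖ₑ ^ 2
          + sobolevWeight (s + ε) n * ‖powCoeff k N u n‖ₑ ^ 2)
          + ENNReal.ofReal (4 * N ^ 2 * δ) * sobolevWeight (s + ε - 1) n * y := by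
      intro n
      by_cases hn : N < 2 * n.natAbs
      · refine le_trans ?_ le_self_add
        calc _ ≤ (ENNReal.ofReal (4 * δ) * sobolevWeight (s + ε) n)
              * (2 * (‖powCoeff k M u n‖ₑ ^ 2 + ‖powCoeff k N u n‖ₑ ^ 2)) := by
              refine mul_le_mul' (sobolevWeight_high_le hε hε1 hN hn)
                ((enorm_sub_sq_le _ _).trans ?_)
              gcongr
              · exact enorm_truncCoeff_le _ _ _ _
              · exact enorm_truncCoeff_le _ _ _ _
          _ = _ := by
              rw [show ENNReal.ofReal (8 * δ) = ENNReal.ofReal (4 * δ) * 2 by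
                rw [show (2 : ℝ≥0∞) = ENNReal.ofReal 2 by simp,
                  ← ENNReal.ofReal_mul (by positivity)]
                congr 1; ring]
              ring
      · have hn : 2 * n.natAbs ≤ N := by omega
        refine le_trans ?_ le_add_self
        have e1 : truncCoeff k M u n = powCoeff k M u n := if_pos (by omega)
        have e2 : truncCoeff k N u n = powCoeff k N u n := if_pos (by omega)
        rw [e1, e2]
        exact mul_le_mul' (sobolevWeight_low_le hε hε1 hN hn) (enorm_powCoeff_sub_sq_le hNM u hn)
    refine (ENNReal.tsum_le_tsum hterm).trans ?_
    rw [ENNReal.tsum_add, ENNReal.tsum_mul_left, ENNReal.tsum_add, ENNReal.tsum_mul_right,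
      ENNReal.tsum_mul_left, ENNReal.ofReal_mul (by positivity) (q := Z)]
    gcongr
  have hmain := ((((hpow m hm M).add hm0 (hpow m hm N) (mΦ M).aemeasurable
      (mΦ N).aemeasurable).const_mul ((mΦ M).add (mΦ N)).aemeasurable
      (ENNReal.ofReal (8 * δ)))).add hm0
    (((momentLE_shellMass hN (q := 2 * m) (by omega)).mul
      (momentLE_quotientTail hk M hN (q := 2 * m) (by omega)) mV.aemeasurable
      mR.aemeasurable).const_mul (mV.mul mR).aemeasurable (ENNReal.ofReal (4 * N ^ 2 * δ * Z)))
    (((mΦ M).add (mΦ N)).const_mul _).aemeasurable ((mV.mul mR).const_mul _).aemeasurable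
  refine hmain.mono hpt (le_of_eq ?_)
  rw [← ENNReal.ofReal_add (by positivity) (by positivity), ← ENNReal.ofReal_mul (by positivity),
    ← ENNReal.ofReal_mul (by positivity), ← ENNReal.ofReal_mul (by positivity),
    ← ENNReal.ofReal_add (by positivity) (by positivity)]
  congr 1
  obtain ⟨d, rfl⟩ : ∃ d, k = d + 1 := ⟨k - 1, by omega⟩
  simp only [Nat.add_sub_cancel] at *
  rw [← hc]
  push_cast
  rw [mul_pow, pow_succ (m : ℝ) d]
  field_simp
  ring

end Differences

/-! ### Removing the truncation -/

section Limit

/-- The `L²(𝕋)` distance between two successive dyadic truncations of the power. -/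
def dyadicGap (k j : ℕ) (u : L2Torus) : ℝ≥0∞ :=
  (∫⁻ x, ‖partialSum (2 ^ (j + 1)) u x ^ k - partialSum (2 ^ j) u x ^ k‖ₑ ^ 2 ∂torusMeasure)
    ^ (1 / 2 : ℝ)

lemma measurable_pow_sub (k M N : ℕ) : Measurable (Function.uncurry fun (u : L2Torus) x =>
    partialSum M u x ^ k - partialSum N u x ^ k) :=
  ((measurable_partialSum M).pow_const k).sub ((measurable_partialSum N).pow_const k)

lemma measurable_dyadicGap (k j : ℕ) : Measurable (dyadicGap k j) := by
  unfold dyadicGap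
  refine Measurable.pow_const ?_ _
  exact ((measurable_pow_sub k _ _).enorm.pow_const 2).lintegral_prod_right

lemma exists_momentLE_dyadicGap {k : ℕ} (hk : 2 ≤ k) : ∃ A : ℝ, 0 ≤ A ∧ ∀ j,
    MomentLE wienerMeasure 2 (dyadicGap k j) (ENNReal.ofReal (A * sqrtScale j)) := by
  set A := (k * monomialSize (k - 1) 2) * gaussSize 2 with hA
  have p1 := monomialSize_nonneg (k - 1) 2
  have p2 := gaussSize_nonneg 2
  refine ⟨A, by positivity, fun j => ?_⟩
  have hpt : ∀ x, MomentLE wienerMeasure 2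
      (fun u => ‖partialSum (2 ^ (j + 1)) u x ^ k - partialSum (2 ^ j) u x ^ k‖ₑ)
      (ENNReal.ofReal (A * sqrtScale j)) := by
    intro x
    have h1 := (holderBound_powQuotient hk (2 ^ (j + 1)) (2 ^ j) (m := 2) (by norm_num)).1 x
    have h2 := momentLE_partialSum_sub (q := 2) (by norm_num) (N := 2 ^ j) (M := 2 ^ (j + 1))
      Nat.one_le_two_pow (Nat.pow_le_pow_right (by norm_num) (by omega)) x
    have m1 : AEMeasurable (fun u => ‖powQuotient k (2 ^ (j + 1)) (2 ^ j) u x‖ₑ) wienerMeasure :=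
      ((measurable_powQuotient k _ _).of_uncurry_right (y := x)).enorm.aemeasurable
    have m2 : AEMeasurable
        (fun u => ‖partialSum (2 ^ (j + 1)) u x - partialSum (2 ^ j) u x‖ₑ) wienerMeasure :=
      ((measurable_partialSum_left _ x).sub (measurable_partialSum_left _ x)).enorm.aemeasurable
    refine (MomentLE.mul h1 h2 m1 m2).mono (fun u => ?_) (le_of_eq ?_)
    · rw [← enorm_mul, powQuotient_mul]
    · rw [← ENNReal.ofReal_natCast, ← ENNReal.ofReal_mul (by positivity),
        ← ENNReal.ofReal_mul (by positivity)]
      congr 1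
      rw [sqrtScale, hA, one_div_pow]
      push_cast
      ring
  have hav := MomentLE.average (ν := torusMeasure) (r := 1) one_ne_zero
    ((measurable_pow_sub k (2 ^ (j + 1)) (2 ^ j)).enorm.pow_const 2)
    (fun x => (hpt x).pow (k := 2) (r := 1))
  have e : ∀ y : ℝ≥0∞, (y ^ (1 / 2 : ℝ)) ^ 2 = y := fun y => by
    rw [← ENNReal.rpow_natCast, ← ENNReal.rpow_mul]; norm_num
  simp only [MomentLE, dyadicGap, e, pow_one] at hav ⊢
  exact hav

lemma ae_tsum_dyadicGap_ne_top {k : ℕ} (hk : 2 ≤ k) :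
    ∀ᵐ u ∂wienerMeasure, ∑' j, dyadicGap k j u ≠ ∞ := by
  obtain ⟨A, hA, h⟩ := exists_momentLE_dyadicGap hk
  have hs := MomentLE.tsum two_ne_zero h (fun j => (measurable_dyadicGap k j).aemeasurable)
  have hsum : Summable fun j => A * sqrtScale j := by
    have : ∀ j, sqrtScale j = √(1 / 2) ^ j := fun j => by
      rw [sqrtScale, Real.sqrt_eq_iff_mul_self_eq (by positivity) (by positivity), ← mul_pow,
        Real.mul_self_sqrt (by norm_num)]
    simp only [this]
    refine (summable_geometric_of_lt_one (by positivity) ?_).mul_left A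
    rw [Real.sqrt_lt' one_pos]; norm_num
  have hfin : ∑' j, ENNReal.ofReal (A * sqrtScale j) ≠ ∞ := hsum.tsum_ofReal_ne_top
  have hlt : ∫⁻ u, (∑' j, dyadicGap k j u) ^ 2 ∂wienerMeasure ≠ ∞ :=
    ne_top_of_le_ne_top (ENNReal.pow_ne_top hfin) hs
  have hm : Measurable fun u => (∑' j, dyadicGap k j u) ^ 2 :=
    (Measurable.tsum fun j => measurable_dyadicGap k j).pow_const 2
  filter_upwards [ae_lt_top hm hlt] with u hu
  intro h0
  simp [h0] at hu

lemma partialSum_ae_eq (N : ℕ) (u : L2Torus) :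
    ((∑ n ∈ Finset.Icc (-(N : ℤ)) N, fourierCoeff (u : Torus → ℂ) n • (fourierLp 2 n : L2Torus) :
      L2Torus) : Torus → ℂ) =ᵐ[torusMeasure] partialSum N u := by
  have h := Lp.coeFn_finsetSum (Finset.Icc (-(N : ℤ)) N)
    (fun n => fourierCoeff (u : Torus → ℂ) n • (fourierLp 2 n : L2Torus))
  have h2 : ∀ᵐ x ∂torusMeasure, ∀ n : ℤ,
      ((fourierCoeff (u : Torus → ℂ) n • (fourierLp 2 n : L2Torus) : L2Torus) : Torus → ℂ) x
        = fourierCoeff (u : Torus → ℂ) n * fourier n x := by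
    rw [ae_all_iff]
    intro n
    filter_upwards [Lp.coeFn_smul (fourierCoeff (u : Torus → ℂ) n) (fourierLp 2 n : L2Torus),
      coeFn_fourierLp 2 n] with x h1 h2
    rw [h1, Pi.smul_apply, h2, smul_eq_mul]
  filter_upwards [h, h2] with x h1 h2
  rw [h1, Finset.sum_apply]
  exact Finset.sum_congr rfl fun n _ => h2 n

/-- Almost surely `u^k` is square-integrable and its Fourier coefficients are the limits of those
of the powers of the dyadic partial sums. -/
lemma ae_memLp_pow_and_tendsto_powCoeff {k : ℕ} (hk : 2 ≤ k) : ∀ᵐ u : L2Torus ∂wienerMeasure,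
    MemLp (fun x => (u : Torus → ℂ) x ^ k) 2 torusMeasure ∧
    ∀ n, Tendsto (fun j => powCoeff k (2 ^ j) u n) atTop
      (𝓝 (fourierCoeff (fun x => (u : Torus → ℂ) x ^ k) n)) := by
  filter_upwards [ae_tsum_dyadicGap_ne_top hk] with u hu
  have hc : ∀ N, MemLp (fun x => partialSum N u x ^ k) 2 torusMeasure := fun N =>
    memLp_of_continuous ((continuous_partialSum N u).pow k) 2
  -- the powers of the dyadic partial sums converge in `L²` to some `G`
  set g : ℕ → L2Torus := fun j => (hc (2 ^ j)).toLp _ with hg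
  have hcau : CauchySeq g := by
    refine cauchySeq_of_edist_le_of_tsum_ne_top (fun j => dyadicGap k j u) (fun j => ?_) hu
    rw [edist_comm, hg, Lp.edist_toLp_toLp, eLpNorm_eq_lintegral_rpow_enorm_toReal (by norm_num)
      (by norm_num)]
    simp [dyadicGap]
  obtain ⟨G, hG⟩ := cauchySeq_tendsto_of_complete hcau
  have hmeas1 := tendstoInMeasure_of_tendsto_Lp hG
  -- along a subsequence the partial sums converge almost everywhere to `u`
  have hL2 : Tendsto (fun j : ℕ => ∑ n ∈ Finset.Icc (-((2 ^ j : ℕ) : ℤ)) ((2 ^ j : ℕ) : ℤ),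
      fourierCoeff (u : Torus → ℂ) n • (fourierLp 2 n : L2Torus)) atTop (𝓝 u) :=
    ((hasSum_fourier_series_L2 u).comp Finset.tendsto_Icc_neg).comp
      (tendsto_pow_atTop_atTop_of_one_lt (by norm_num : 1 < 2))
  obtain ⟨ns, hns, hae⟩ := (tendstoInMeasure_of_tendsto_Lp hL2).exists_seq_tendsto_ae
  have hpow : ∀ᵐ x ∂torusMeasure, Tendsto (fun i => (g (ns i) : Torus → ℂ) x) atTop
      (𝓝 ((u : Torus → ℂ) x ^ k)) := by
    have e1 : ∀ᵐ x ∂torusMeasure, ∀ j, (g j : Torus → ℂ) x = partialSum (2 ^ j) u x ^ k :=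
      ae_all_iff.mpr fun j => (hc (2 ^ j)).coeFn_toLp
    have e2 := ae_all_iff.mpr fun j : ℕ => partialSum_ae_eq (2 ^ j) u
    filter_upwards [hae, e1, e2] with x h1 h2 h3
    simp only [h2]
    simp only [h3] at h1
    exact h1.pow k
  have hmeas2 := tendstoInMeasure_of_tendsto_ae
    (fun i => Lp.aestronglyMeasurable (g (ns i))) hpow
  have heq : (G : Torus → ℂ) =ᵐ[torusMeasure] fun x => (u : Torus → ℂ) x ^ k :=
    tendstoInMeasure_ae_unique (hmeas1.comp hns.tendsto_atTop) hmeas2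
  refine ⟨(memLp_congr_ae heq).mp (Lp.memLp G), fun n => ?_⟩
  rw [← fourierCoeff_congr_ae heq]
  have := ((continuous_fourierCoeff_L2 n).tendsto G).comp hG
  refine this.congr fun j => ?_
  simp only [Function.comp, hg]
  rw [fourierCoeff_congr_ae (hc (2 ^ j)).coeFn_toLp]
  rfl

lemma truncPow_coe (k N : ℕ) (u : L2Torus) : truncPow k (N : ℕ∞) u
    = ∑ j ∈ Finset.Icc (-(N : ℤ)) N, fun x => powCoeff k N u j * fourier j x := by
  ext x
  rw [Finset.sum_apply]
  rfl

lemma integrable_truncPow_coe (k N : ℕ) (u : L2Torus) :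
    Integrable (truncPow k (N : ℕ∞) u) torusMeasure := by
  rw [truncPow_coe]
  exact integrable_finsetSum' _ fun j _ =>
    integrable_of_continuous ((fourier j).continuous.const_mul _)

lemma fourierCoeff_truncPow_coe (k N : ℕ) (u : L2Torus) (n : ℤ) :
    fourierCoeff (truncPow k (N : ℕ∞) u) n = truncCoeff k N u n := by
  rw [truncPow_coe, fourierCoeff.sum _ _ (fun j _ =>
    integrable_of_continuous ((fourier j).continuous.const_mul _)), Finset.sum_apply]
  simp only [fourierCoeff.const_mul]
  have h1 : ∀ j : ℤ,
      fourierCoeff (fun x : Torus => (fourier j x : ℂ)) n = if n = j then 1 else 0 := by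
    intro j
    rw [show (fun x : Torus => (fourier j x : ℂ)) = ⇑(fourier j : C(Torus, ℂ)) from rfl,
      fourierCoeff_fourier, Pi.single_apply]
  simp only [h1, mul_ite, mul_one, mul_zero, Finset.sum_ite_eq, Finset.mem_Icc, truncCoeff]
  congr 1
  simp only [eq_iff_iff]
  omega

lemma ae_tendsto_truncCoeff {k : ℕ} (hk : 2 ≤ k) : ∀ᵐ u ∂wienerMeasure,
    Integrable (truncPow k ⊤ u) torusMeasure ∧
    ∀ n, Tendsto (fun j => truncCoeff k (2 ^ j) u n) atTop
      (𝓝 (fourierCoeff (truncPow k ⊤ u) n)) := by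
  filter_upwards [ae_memLp_pow_and_tendsto_powCoeff hk] with u hu
  refine ⟨hu.1.integrable (by norm_num), fun n => ?_⟩
  refine (hu.2 n).congr' ?_
  filter_upwards [eventually_ge_atTop n.natAbs] with j hj
  exact (if_pos (hj.trans (Nat.lt_two_pow_self).le)).symm

/-- Fatou's lemma for weighted `ℓ²` norms. -/
lemma tsum_weight_le_liminf {w : ℤ → ℝ≥0∞} (hw : ∀ n, w n ≠ ∞) {a : ℕ → ℤ → ℂ} {b : ℤ → ℂ}
    (h : ∀ n, Tendsto (fun j => a j n) atTop (𝓝 (b n))) :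
    ∑' n, w n * ‖b n‖ₑ ^ 2 ≤ liminf (fun j => ∑' n, w n * ‖a j n‖ₑ ^ 2) atTop := by
  have h1 : ∀ n, liminf (fun j => w n * ‖a j n‖ₑ ^ 2) atTop = w n * ‖b n‖ₑ ^ 2 := fun n =>
    (ENNReal.Tendsto.const_mul ((ENNReal.continuous_pow 2).tendsto _ |>.comp (h n).enorm)
      (Or.inr (hw n))).liminf_eq
  simp only [← h1, ← lintegral_count]
  exact lintegral_liminf_le fun j => measurable_of_countable _

end Limit

/-! ### Estimates in `L^p(ρ; H^s)` -/

section Sobolev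

lemma sobolevWeight_ne_top (s : ℝ) (n : ℤ) : sobolevWeight s n ≠ ∞ := ENNReal.ofReal_ne_top

lemma aemeasurable_fourierCoeff_truncPow {k : ℕ} (hk : 2 ≤ k) (N : ℕ∞) (n : ℤ) :
    AEMeasurable (fun u => fourierCoeff (truncPow k N u) n) wienerMeasure := by
  induction N using ENat.recTopCoe with
  | top =>
    refine aemeasurable_of_tendsto_metrizable_ae atTop
      (fun j => (measurable_truncCoeff k (2 ^ j) n).aemeasurable) ?_
    filter_upwards [ae_tendsto_truncCoeff hk] with u hu
    exact hu.2 n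
  | coe N =>
    simp only [fourierCoeff_truncPow_coe]
    exact (measurable_truncCoeff k N n).aemeasurable

lemma exists_momentLE_truncPow {k : ℕ} (hk : 2 ≤ k) {s : ℝ} (hs : s < 1 / 2) :
    ∃ B : ℝ, 0 < B ∧ ∀ m : ℕ, 1 ≤ m → ∀ N : ℕ∞, MomentLE wienerMeasure m
      (fun u => ∑' n : ℤ, sobolevWeight s n * ‖fourierCoeff (truncPow k N u) n‖ₑ ^ 2)
      (ENNReal.ofReal (B * (m : ℝ) ^ k)) := by
  obtain ⟨B, hB, h⟩ := exists_momentLE_powCoeff hk hs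
  have hfin : ∀ m : ℕ, 1 ≤ m → ∀ N : ℕ, MomentLE wienerMeasure m
      (fun u => ∑' n : ℤ, sobolevWeight s n * ‖truncCoeff k N u n‖ₑ ^ 2)
      (ENNReal.ofReal (B * (m : ℝ) ^ k)) := fun m hm N => by
    refine (h m hm N).mono (fun u => ENNReal.tsum_le_tsum fun n => ?_) le_rfl
    gcongr
    exact enorm_truncCoeff_le k N u n
  refine ⟨B, hB, fun m hm N => ?_⟩
  induction N using ENat.recTopCoe with
  | top =>
    refine MomentLE.of_le_liminf (fun j => hfin m hm (2 ^ j)) (fun j => ?_) ?_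
    · exact (Measurable.tsum fun n =>
        ((measurable_truncCoeff k _ n).enorm.pow_const 2).const_mul _).aemeasurable
    · filter_upwards [ae_tendsto_truncCoeff hk] with u hu
      exact tsum_weight_le_liminf (sobolevWeight_ne_top s) hu.2
  | coe N =>
    simp only [fourierCoeff_truncPow_coe]
    exact hfin m hm N

lemma exists_momentLE_truncPow_sub {k : ℕ} (hk : 2 ≤ k) {s ε : ℝ} (hε : 0 < ε) (hε1 : ε ≤ 1)
    (hs : s + ε < 1 / 2) :
    ∃ B : ℝ, 0 < B ∧ ∀ m : ℕ, 1 ≤ m → ∀ N : ℕ, 1 ≤ N → ∀ M : ℕ∞, (N : ℕ∞) ≤ M →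
      MomentLE wienerMeasure m
        (fun u => ∑' n : ℤ, sobolevWeight s n *
          ‖fourierCoeff (truncPow k M u) n - fourierCoeff (truncPow k N u) n‖ₑ ^ 2)
        (ENNReal.ofReal (B * (m : ℝ) ^ k * ((N : ℝ) ^ (2 * ε))⁻¹)) := by
  obtain ⟨B, hB, h⟩ := exists_momentLE_truncCoeff_sub hk hε hε1 hs
  refine ⟨B, hB, fun m hm N hN M hM => ?_⟩
  simp only [fourierCoeff_truncPow_coe]
  induction M using ENat.recTopCoe with
  | top =>
    have hj : ∀ j, N ≤ 2 ^ (j + N) := fun j =>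
      (Nat.lt_two_pow_self (n := N)).le.trans (Nat.pow_le_pow_right (by norm_num) (by omega))
    refine MomentLE.of_le_liminf (fun j => h m hm N (2 ^ (j + N)) hN (hj j)) (fun j => ?_) ?_
    · exact (Measurable.tsum fun n => (((measurable_truncCoeff k _ n).sub
        (measurable_truncCoeff k _ n)).enorm.pow_const 2).const_mul _).aemeasurable
    · filter_upwards [ae_tendsto_truncCoeff hk] with u hu
      refine tsum_weight_le_liminf (sobolevWeight_ne_top s) fun n => ?_
      exact ((hu.2 n).comp (tendsto_add_atTop_nat N)).sub_const _
  | coe M =>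
    simp only [fourierCoeff_truncPow_coe]
    exact h m hm N M hN (by exact_mod_cast hM)

lemma enorm_weight_mul_sq (s : ℝ) (n : ℤ) (z : ℂ) :
    ‖(((1 + (n : ℝ) ^ 2) ^ (s / 2) : ℝ) : ℂ) * z‖ₑ ^ 2 = sobolevWeight s n * ‖z‖ₑ ^ 2 := by
  have hp : (0 : ℝ) < 1 + (n : ℝ) ^ 2 := by positivity
  rw [enorm_mul, mul_pow, sobolevWeight]
  congr 1
  rw [← ofReal_norm, ← ENNReal.ofReal_pow (by positivity), Complex.norm_real,
    Real.norm_of_nonneg (by positivity), ← Real.rpow_natCast, ← Real.rpow_mul hp.le]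
  norm_num

lemma enorm_weightedCoeff_sq (s : ℝ) (f : Torus → ℂ) (n : ℤ) :
    ‖weightedCoeff s f n‖ₑ ^ 2 = sobolevWeight s n * ‖fourierCoeff f n‖ₑ ^ 2 :=
  enorm_weight_mul_sq s n _

lemma memHs_of_tsum_ne_top {s : ℝ} {f : Torus → ℂ} (hf : Integrable f torusMeasure)
    (h : ∑' n : ℤ, sobolevWeight s n * ‖fourierCoeff f n‖ₑ ^ 2 ≠ ∞) : MemHs s f := by
  refine ⟨hf, memℓp_gen ?_⟩
  simp only [← enorm_weightedCoeff_sq] at h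
  have := ENNReal.summable_toReal h
  simpa using this

lemma enorm_sq_lp (x : lp (fun _ : ℤ => ℂ) 2) : ‖x‖ₑ ^ 2 = ∑' n, ‖x n‖ₑ ^ 2 := by
  have h := lp.hasSum_norm (p := 2) (by norm_num) x
  simp only [ENNReal.toReal_ofNat, Real.rpow_ofNat] at h
  rw [← ofReal_norm, ← ENNReal.ofReal_pow (norm_nonneg _), ← h.tsum_eq,
    ENNReal.ofReal_tsum_of_nonneg (fun _ => by positivity) h.summable]
  refine tsum_congr fun n => ?_
  rw [ENNReal.ofReal_pow (norm_nonneg _), ofReal_norm]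

lemma toHs_apply {s : ℝ} {f : Torus → ℂ} (h : MemHs s f) (n : ℤ) :
    toHs s f n = weightedCoeff s f n := by
  rw [toHs, dif_pos h]

lemma enorm_toHs_sq {s : ℝ} {f : Torus → ℂ} (h : MemHs s f) :
    ‖toHs s f‖ₑ ^ 2 = ∑' n : ℤ, sobolevWeight s n * ‖fourierCoeff f n‖ₑ ^ 2 := by
  rw [enorm_sq_lp]
  refine tsum_congr fun n => ?_
  rw [toHs_apply h, enorm_weightedCoeff_sq]

lemma enorm_toHs_sub_sq {s : ℝ} {f g : Torus → ℂ} (hf : MemHs s f) (hg : MemHs s g) :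
    ‖toHs s f - toHs s g‖ₑ ^ 2
      = ∑' n : ℤ, sobolevWeight s n * ‖fourierCoeff f n - fourierCoeff g n‖ₑ ^ 2 := by
  rw [enorm_sq_lp]
  refine tsum_congr fun n => ?_
  rw [lp.coeFn_sub, Pi.sub_apply, toHs_apply hf, toHs_apply hg, weightedCoeff, weightedCoeff,
    ← mul_sub, enorm_weight_mul_sq]

lemma ae_memHs_truncPow {k : ℕ} (hk : 2 ≤ k) {s : ℝ} (hs : s < 1 / 2) (N : ℕ∞) :
    ∀ᵐ u ∂wienerMeasure, MemHs s (truncPow k N u) := by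
  obtain ⟨B, hB, h⟩ := exists_momentLE_truncPow hk hs
  have h1 := h 1 le_rfl N
  have hm : AEMeasurable (fun u => ∑' n : ℤ,
      sobolevWeight s n * ‖fourierCoeff (truncPow k N u) n‖ₑ ^ 2) wienerMeasure :=
    AEMeasurable.tsum fun n =>
      ((aemeasurable_fourierCoeff_truncPow hk N n).enorm.pow_const 2).const_mul _
  simp only [MomentLE, pow_one] at h1
  have hi : ∀ᵐ u ∂wienerMeasure, Integrable (truncPow k N u) torusMeasure := by
    induction N using ENat.recTopCoe with
    | top => filter_upwards [ae_tendsto_truncCoeff hk] with u hu using hu.1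
    | coe N => exact Eventually.of_forall fun u => integrable_truncPow_coe k N u
  filter_upwards [hi, ae_lt_top' hm (ne_top_of_le_ne_top ENNReal.ofReal_ne_top h1)] with u h2 h3
  exact memHs_of_tsum_ne_top h2 h3.ne

lemma aestronglyMeasurable_toHs_truncPow {k : ℕ} (hk : 2 ≤ k) {s : ℝ} (hs : s < 1 / 2)
    (N : ℕ∞) : AEStronglyMeasurable (fun u => toHs s (truncPow k N u)) wienerMeasure := by
  refine aestronglyMeasurable_of_tendsto_ae (atTop : Filter (Finset ℤ))
    (f := fun A u => ∑ n ∈ A, lp.single (E := fun _ : ℤ => ℂ) 2 n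
      (weightedCoeff s (truncPow k N u) n)) (fun A => ?_) ?_
  · refine Finset.aestronglyMeasurable_fun_sum _ fun n _ => ?_
    have hc := (lp.isometry_single (E := fun _ : ℤ => ℂ) (p := 2) n).continuous
    refine hc.comp_aestronglyMeasurable ?_
    exact ((aemeasurable_fourierCoeff_truncPow hk N n).const_mul _).aestronglyMeasurable
  · filter_upwards [ae_memHs_truncPow hk hs N] with u hu
    have := lp.hasSum_single (E := fun _ : ℤ => ℂ) (p := 2) (by norm_num) (toHs s (truncPow k N u))
    simp only [toHs_apply hu] at this
    exact this

/-- Bounds for all even moments give bounds for all real exponents, with the growth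
`(max p 2 - 1)^{k/2}`: the even integer `2m` above `max p 2` satisfies
`m ≤ 2 (max p 2 - 1)`. -/
lemma eLpNorm_le_of_momentLE {E : Type*} [NormedAddCommGroup E] {g : L2Torus → E}
    (hg : AEStronglyMeasurable g wienerMeasure) {k : ℕ} {B : ℝ} (hB : 0 ≤ B)
    (h : ∀ m : ℕ, 1 ≤ m →
      MomentLE wienerMeasure m (fun u => ‖g u‖ₑ ^ 2) (ENNReal.ofReal (B * (m : ℝ) ^ k)))
    {p : ℝ} (hp : 1 ≤ p) :
    eLpNorm g (ENNReal.ofReal p) wienerMeasure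
      ≤ ENNReal.ofReal (√(B * 2 ^ k) * (max p 2 - 1) ^ ((k : ℝ) / 2)) := by
  set P := max p 2 with hP
  have hP2 : 2 ≤ P := le_max_right _ _
  set m := ⌈P / 2⌉₊ with hm
  have hm1 : 1 ≤ m := Nat.one_le_iff_ne_zero.mpr (Nat.ceil_pos.mpr (by linarith)).ne'
  have hmP : P ≤ 2 * m := by linarith [Nat.le_ceil (P / 2)]
  have hmP' : (m : ℝ) ≤ 2 * (P - 1) := by
    linarith [Nat.ceil_lt_add_one (show 0 ≤ P / 2 by linarith)]
  have hm0 : (0 : ℝ) < m := by exact_mod_cast hm1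
  have h1 : eLpNorm g (ENNReal.ofReal p) wienerMeasure
      ≤ eLpNorm g (ENNReal.ofReal (2 * m)) wienerMeasure :=
    eLpNorm_le_eLpNorm_of_exponent_le
      (ENNReal.ofReal_le_ofReal ((le_max_left p 2).trans hmP)) hg
  refine h1.trans ?_
  rw [eLpNorm_eq_lintegral_rpow_enorm_toReal (by simpa using (by omega : m ≠ 0))
    ENNReal.ofReal_ne_top,
    ENNReal.toReal_ofReal (by positivity), one_div, ENNReal.rpow_inv_le_iff (by positivity)]
  have h2 := h m hm1
  unfold MomentLE at h2
  have e1 : ∀ y : ℝ≥0∞, y ^ (2 * (m : ℝ)) = (y ^ 2) ^ m := fun y => by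
    rw [ENNReal.rpow_mul, ENNReal.rpow_ofNat, ENNReal.rpow_natCast]
  simp only [e1]
  refine h2.trans ?_
  gcongr
  have hP1 : 0 ≤ P - 1 := by linarith
  rw [← ENNReal.ofReal_pow (by positivity)]
  refine ENNReal.ofReal_le_ofReal ?_
  have e2 : ((P - 1) ^ ((k : ℝ) / 2)) ^ 2 = (P - 1) ^ k := by
    rw [← Real.rpow_natCast, ← Real.rpow_mul hP1, ← Real.rpow_natCast]
    congr 1; push_cast; ring
  rw [mul_pow, e2, Real.sq_sqrt (by positivity), mul_assoc, ← mul_pow]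
  gcongr

lemma exists_eLpNorm_toHs_truncPow_sub_le {k : ℕ} (hk : 2 ≤ k) {s ε : ℝ} (hε : 0 < ε)
    (hε1 : ε ≤ 1) (hs : s + ε < 1 / 2) :
    ∃ C : ℝ, 0 < C ∧ ∀ p : ℝ, 1 ≤ p → ∀ N : ℕ, 1 ≤ N → ∀ M : ℕ∞, (N : ℕ∞) ≤ M →
      eLpNorm (fun u => toHs s (truncPow k M u) - toHs s (truncPow k N u))
          (ENNReal.ofReal p) wienerMeasure
        ≤ ENNReal.ofReal (C * (max p 2 - 1) ^ ((k : ℝ) / 2) * (1 / (N : ℝ) ^ ε)) := by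
  have hs' : s < 1 / 2 := by linarith
  obtain ⟨B, hB, h⟩ := exists_momentLE_truncPow_sub hk hε hε1 hs
  refine ⟨√(B * 2 ^ k), by positivity, fun p hp N hN M hM => ?_⟩
  have hN' : (0 : ℝ) < N := by exact_mod_cast hN
  have hmeas := (aestronglyMeasurable_toHs_truncPow hk hs' M).sub
    (aestronglyMeasurable_toHs_truncPow hk hs' (N : ℕ∞))
  refine (eLpNorm_le_of_momentLE (k := k) (B := B * ((N : ℝ) ^ (2 * ε))⁻¹) hmeas (by positivity)
    (fun m hm => (h m hm N hN M hM).mono_ae ?_ (le_of_eq ?_)) hp).trans (le_of_eq ?_)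
  · filter_upwards [ae_memHs_truncPow hk hs' M, ae_memHs_truncPow hk hs' (N : ℕ∞)] with u h1 h2
    exact (enorm_toHs_sub_sq h1 h2).le
  · congr 1; ring
  · have e : √(B * ((N : ℝ) ^ (2 * ε))⁻¹ * 2 ^ k) = √(B * 2 ^ k) * (1 / (N : ℝ) ^ ε) := by
      rw [mul_right_comm, Real.sqrt_mul (by positivity), Real.sqrt_inv, mul_comm 2 ε,
        Real.rpow_mul hN'.le, Real.rpow_two, Real.sqrt_sq (by positivity), one_div]
    rw [e]
    congr 1; ring

end Sobolev

end BrownianLoop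

end

open BrownianLoop in
theorem proposition3p1 (k : ℕ) (hk : 2 ≤ k) (s : ℝ) (hs : s < 1 / 2) :
    (∃ C : ℝ, 0 < C ∧ ∀ p : ℝ, 1 ≤ p → ∀ N : ℕ∞,
      (∀ᵐ u ∂wienerMeasure, MemHs s (truncPow k N u)) ∧
      MemLp (fun u => toHs s (truncPow k N u)) (ENNReal.ofReal p) wienerMeasure ∧
      eLpNorm (fun u => toHs s (truncPow k N u)) (ENNReal.ofReal p) wienerMeasure
        ≤ ENNReal.ofReal (C * (max p 2 - 1) ^ ((k : ℝ) / 2))) ∧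
    (∀ ε : ℝ, 0 < ε → ε ≤ 1 → s + ε < 1 / 2 →
      ∃ C : ℝ, 0 < C ∧ ∀ p : ℝ, 1 ≤ p → ∀ N : ℕ, 1 ≤ N → ∀ M : ℕ∞, (N : ℕ∞) ≤ M →
        eLpNorm (fun u => toHs s (truncPow k M u) - toHs s (truncPow k N u))
            (ENNReal.ofReal p) wienerMeasure
          ≤ ENNReal.ofReal (C * (max p 2 - 1) ^ ((k : ℝ) / 2) * (1 / (N : ℝ) ^ ε))) ∧
    (∀ p : ℝ, 1 ≤ p →
      Tendsto (fun N : ℕ =>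
        eLpNorm (fun u => toHs s (truncPow k N u) - toHs s (truncPow k ⊤ u))
          (ENNReal.ofReal p) wienerMeasure) atTop (𝓝 0)) := by
  refine ⟨?_, fun ε hε hε1 hsε => exists_eLpNorm_toHs_truncPow_sub_le hk hε hε1 hsε,
    fun p hp => ?_⟩
  · obtain ⟨B, hB, h⟩ := exists_momentLE_truncPow hk hs
    refine ⟨√(B * 2 ^ k), by positivity, fun p hp N => ?_⟩
    have hmeas := aestronglyMeasurable_toHs_truncPow hk hs N
    have hae := ae_memHs_truncPow hk hs N
    have hle := eLpNorm_le_of_momentLE (k := k) hmeas hB.le (fun m hm =>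
      (h m hm N).mono_ae (hae.mono fun u hu => (enorm_toHs_sq hu).le) le_rfl) hp
    exact ⟨hae, ⟨hmeas, hle.trans_lt ENNReal.ofReal_lt_top⟩, hle⟩
  · set ε := min 1 ((1 / 2 - s) / 2) with hεdef
    have hε : 0 < ε := lt_min one_pos (by linarith)
    have hsε : s + ε < 1 / 2 := by linarith [min_le_right 1 ((1 / 2 - s) / 2)]
    obtain ⟨C, hC, h⟩ := exists_eLpNorm_toHs_truncPow_sub_le hk hε (min_le_left _ _) hsε
    have hlim : Tendsto (fun N : ℕ => ENNReal.ofReal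
        (C * (max p 2 - 1) ^ ((k : ℝ) / 2) * (1 / (N : ℝ) ^ ε))) atTop (𝓝 0) := by
      rw [← ENNReal.ofReal_zero]
      refine ENNReal.tendsto_ofReal ?_
      rw [← mul_zero (C * (max p 2 - 1) ^ ((k : ℝ) / 2))]
      refine Tendsto.const_mul _ ?_
      simp only [one_div]
      exact ((tendsto_rpow_atTop hε).comp tendsto_natCast_atTop_atTop).inv_tendsto_atTop
    refine tendsto_of_tendsto_of_tendsto_of_le_of_le' tendsto_const_nhds hlim
      (Eventually.of_forall fun _ => zero_le) ?_
    filter_upwards [eventually_ge_atTop 1] with N hN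
    exact (eLpNorm_sub_comm _ _ _ _).trans_le (h p hp N hN ⊤ le_top)
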